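/- Let $M\ge 1$, $\Delta_T>0$, and consider a linear array of $2M+1$ elements at $\mathbf p_m=(0,m\Delta_T,0)^T\in\mathbb R^3$, $m=-M,\dots,M$. Fix $\lambda>0$, $\bar P>0$, $\sigma^2>0$, $\xi\in\mathbb C$ and $t_{\mathrm{pol}}\in\{1,2,3\}$. For $\mathbf r\in\mathbb R^3$ put $$h_m(\mathbf r)=\frac{\xi}{\lambda}\,\frac{e^{-\mathrm j\frac{2\pi}{\lambda}\|\mathbf r-\mathbf p_m\|}}{\|\mathbf r-\mathbf p_m\|},\qquad \mathbf H_m(\mathbf r)=h_m(\mathbf r)\Big(\mathbf I_3-\frac{(\mathbf r-\mathbf p_m)(\mathbf r-\mathbf p_m)^T}{\|\mathbf r-\mathbf p_m\|^2}\Big),$$ and let $\mathbf H_{\mathrm{pol}}(\mathbf r)$ be the $3\times(2M+1)t_{\mathrm{pol}}$ matrix whose blocks are the first $t_{\mathrm{pol}}$ columns of $\mathbf H_{-M}(\mathbf r),\dots,\mathbf H_M(\mathbf r)$. Let $\mathbf r_0=(0,y_0,z_0)^T$ be a point of the $yz$-plane with $z_0\neq0$, let $\mathbf w$ be a unit-norm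 right singular vector of $\mathbf H_{\mathrm{pol}}(\mathbf r_0)/\sqrt{2M+1}$ associated with its maximum singular value, and define $$\mathsf{SNR}(\mathbf r)=\bar P\,\frac{\mathbf w^H\mathbf H_{\mathrm{pol}}^H(\mathbf r)\mathbf H_{\mathrm{pol}}(\mathbf r)\mathbf w}{\sigma^2(2M+1)}.$$ For $k\in\mathbb N$ write $$s_M^{(k)}=\frac1{2M+1}\sum_{m=-M}^M\frac1{\|\mathbf r_0-\mathbf p_m\|^k},\qquad \bar s_M^{(k)}=\frac1{2M+1}\sum_{m=-M}^M\frac{m\Delta_T-y_0}{\|\mathbf r_0-\mathbf p_m\|^{k+1}},$$ and $\mathbf\Delta_r=\mathbf r-\mathbf r_0$. Then $$\mathsf{SNR}(\mathbf r)=\mathsf{SNR}(\mathbf r_0)\big[1-\big(2\mathbf\Delta_r^T\mathfrak m_M+\mathbf\Delta_r^T\mathcal M_M\mathbf\Delta_r\big)\big]+\epsilon_M,$$ where $\mathfrak m_M=[0,(\mathfrak m_M^{(2)})^T]^T$ with $\mathfrak m_M^{(2)}=\frac1{s_M^{(2)}}\big[-\bar s_M^{(3)},\ z_0s_M^{(4)}\big]^T$,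 and $\mathcal M_M$ is the block-diagonal matrix with diagonal blocks the scalar $$\gamma_M^{(1)}=\frac1{(s_M^{(2)})^2}\Big[3s_M^{(2)}s_M^{(4)}-(\bar s_M^{(3)})^2-z_0^2(s_M^{(4)})^2\Big]$$ and the $2\times2$ matrix $\mathcal M_M^{(2)}=\mathcal A_M+(2\pi/\lambda)^2\mathcal B_M$, with $$\mathcal A_M=\frac1{(s_M^{(2)})^2}\begin{bmatrix}(3z_0^2s_M^{(6)}-2s_M^{(4)})s_M^{(2)}-(\bar s_M^{(3)})^2&(s_M^{(4)}\bar s_M^{(3)}+3s_M^{(2)}\bar s_M^{(5)})z_0\\(s_M^{(4)}\bar s_M^{(3)}+3\bar s_M^{(5)}s_M^{(2)})z_0&(s_M^{(4)}-3s_M^{(6)}z_0^2)s_M^{(2)}-(s_M^{(4)}z_0)^2\end{bmatrix},$$ $$\mathcal B_M=\frac1{(s_M^{(2)})^2}\begin{bmatrix}(s_M^{(2)})^2-z_0^2s_M^{(2)}s_M^{(4)}-(\bar s_M^{(2)})^2&(\bar s_M^{(2)}s_M^{(3)}-\bar s_M^{(3)}s_M^{(2)})z_0\\(s_M^{(3)}\bar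 s_M^{(2)}-\bar s_M^{(3)}s_M^{(2)})z_0&z_0^2(s_M^{(4)}s_M^{(2)}-(s_M^{(3)})^2)\end{bmatrix}.$$ The error term is of third order: there is a polynomial $\mathrm P$ whose coefficients depend only on $|\xi|,\bar P,\sigma^2,\lambda$ (and not on $M$, $\Delta_T$, $t_{\mathrm{pol}}$, $\mathbf r_0$, $\mathbf r$ or $\mathbf w$) such that $$|\epsilon_M|\le\mathrm P(1/\rho)\,\|\mathbf\Delta_r\|^3$$ whenever $\rho>0$ and every point of the segment joining $\mathbf r_0$ and $\mathbf r$ is at distance at least $\rho$ from every array element (for instance $\rho=\min\{z,z_0\}$ if $z_0>0$ and $\mathbf r$ has third coordinate $z>0$). Moreover $\gamma_M^{(1)}\ge0$ always (this also for $M=0$). -/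

import Mathlib

open scoped Matrix

noncomputable section

namespace Beamfocusing

/-- Points of physical space, with cartesian coordinates `x = r 0`, `y = r 1`, `z = r 2`
and the Euclidean norm. -/
abbrev Space : Type := EuclideanSpace ℝ (Fin 3)

/-- The indices `m = -M, …, M` of the elements of the linear array. -/
abbrev ArrayIdx (M : ℕ) : Type := ↥(Finset.Icc (-(M : ℤ)) (M : ℤ))

/-- Position `p_m = (0, m Δ_T, 0)` of the `m`-th element of the array on the `y`-axis. -/
def elementPos (ΔT : ℝ) (m : ℤ) : Space := !₂[0, (m : ℝ) * ΔT, 0]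

/-- The scalar channel
`h_m(r) = (ξ / λ) ‖r - p_m‖⁻¹ exp(-j (2π / λ) ‖r - p_m‖)`. -/
def scalarChannel (ξ : ℂ) (lam ΔT : ℝ) (m : ℤ) (r : Space) : ℂ :=
  ξ / (lam : ℂ) * (1 / (‖r - elementPos ΔT m‖ : ℂ)) *
    Complex.exp (-(Complex.I * (((2 * Real.pi / lam) * ‖r - elementPos ΔT m‖ : ℝ) : ℂ)))

/-- The orthogonal projection matrix `P_m(r)` onto the line spanned by `r - p_m`. -/
def proj (ΔT : ℝ) (m : ℤ) (r : Space) : Matrix (Fin 3) (Fin 3) ℝ :=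
  (1 / ‖r - elementPos ΔT m‖ ^ 2) •
    Matrix.vecMulVec (r - elementPos ΔT m).ofLp (r - elementPos ΔT m).ofLp

/-- The complementary projection matrix `I₃ - P_m(r)`. -/
def projPerp (ΔT : ℝ) (m : ℤ) (r : Space) : Matrix (Fin 3) (Fin 3) ℝ :=
  1 - proj ΔT m r

/-- The `3 × 3` channel matrix `H_m(r) = h_m(r) (I₃ - P_m(r))`. -/
def elementChannel (ξ : ℂ) (lam ΔT : ℝ) (m : ℤ) (r : Space) : Matrix (Fin 3) (Fin 3) ℂ :=
  scalarChannel ξ lam ΔT m r • (projPerp ΔT m r).map (fun a : ℝ => (a : ℂ))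

/-- The channel matrix `H_pol(r)`: the blocks `H_{-M}(r), …, H_M(r)` side by side, where only
the first `t` columns of each block are kept (`t` transmit polarizations, three receive
polarizations). The column `(m, j)` is the `j`-th column of the block `m`. -/
def channel (M t : ℕ) (ht : t ≤ 3) (ξ : ℂ) (lam ΔT : ℝ) (r : Space) :
    Matrix (Fin 3) (ArrayIdx M × Fin t) ℂ :=
  Matrix.of fun i c => elementChannel ξ lam ΔT (c.1 : ℤ) r i (Fin.castLE ht c.2)

/-- `s` is a singular value of `A`, with left singular vector `u` and right singular
vector `v`. -/
def IsSingularTriple {m n : Type*} [Fintype m] [Fintype n] (A : Matrix m n ℂ)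
    (s : ℝ) (u : m → ℂ) (v : n → ℂ) : Prop :=
  0 ≤ s ∧ star u ⬝ᵥ u = 1 ∧ star v ⬝ᵥ v = 1 ∧
    A *ᵥ v = (s : ℂ) • u ∧ Aᴴ *ᵥ u = (s : ℂ) • v

/-- `u` and `v` are a left and a right singular vector of `A` associated with its maximum
singular value. -/
def IsMaxSingularPair {m n : Type*} [Fintype m] [Fintype n] (A : Matrix m n ℂ)
    (u : m → ℂ) (v : n → ℂ) : Prop :=
  ∃ s : ℝ, IsSingularTriple A s u v ∧
    ∀ (s' : ℝ) (u' : m → ℂ) (v' : n → ℂ), IsSingularTriple A s' u' v' → s' ≤ s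

/-- The signal to noise ratio at `r` when the transmit filter is `w`:
`SNR(r) = P̄ wᴴ H_pol(r)ᴴ H_pol(r) w / (σ² (2M + 1))`. Here `sigma2` is the noise power `σ²`;
the Hermitian form is real, so its real part is taken. -/
def snr (Pbar sigma2 : ℝ) (M t : ℕ) (ht : t ≤ 3) (ξ : ℂ) (lam ΔT : ℝ)
    (w : ArrayIdx M × Fin t → ℂ) (r : Space) : ℝ :=
  Pbar * (star w ⬝ᵥ (((channel M t ht ξ lam ΔT r)ᴴ * channel M t ht ξ lam ΔT r) *ᵥ w)).re /
    (sigma2 * (2 * (M : ℝ) + 1))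

/-- `s_M^{(k)} = (2M + 1)⁻¹ ∑_{m=-M}^{M} ‖r₀ - p_m‖^{-k}`. -/
def arraySum (M : ℕ) (ΔT : ℝ) (r₀ : Space) (k : ℕ) : ℝ :=
  1 / (2 * (M : ℝ) + 1) *
    ∑ m ∈ Finset.Icc (-(M : ℤ)) (M : ℤ), 1 / ‖r₀ - elementPos ΔT m‖ ^ k

/-- `s̄_M^{(k)} = (2M + 1)⁻¹ ∑_{m=-M}^{M} (m Δ_T - y₀) ‖r₀ - p_m‖^{-(k+1)}`. -/
def arraySumBar (M : ℕ) (ΔT : ℝ) (r₀ : Space) (k : ℕ) : ℝ :=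
  1 / (2 * (M : ℝ) + 1) *
    ∑ m ∈ Finset.Icc (-(M : ℤ)) (M : ℤ),
      ((m : ℝ) * ΔT - r₀ 1) / ‖r₀ - elementPos ΔT m‖ ^ (k + 1)

/-- The vector `m_M^{(2)}`. -/
def mVec2 (M : ℕ) (ΔT : ℝ) (r₀ : Space) : Fin 2 → ℝ :=
  (1 / arraySum M ΔT r₀ 2) • ![-arraySumBar M ΔT r₀ 3, r₀ 2 * arraySum M ΔT r₀ 4]

/-- The vector `m_M = (0, m_M^{(2)})`. -/
def mVec (M : ℕ) (ΔT : ℝ) (r₀ : Space) : Fin 3 → ℝ :=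
  ![0, mVec2 M ΔT r₀ 0, mVec2 M ΔT r₀ 1]

/-- The scalar `γ_M^{(1)}`. -/
def gammaOne (M : ℕ) (ΔT : ℝ) (r₀ : Space) : ℝ :=
  1 / arraySum M ΔT r₀ 2 ^ 2 *
    (3 * arraySum M ΔT r₀ 2 * arraySum M ΔT r₀ 4 - arraySumBar M ΔT r₀ 3 ^ 2
      - r₀ 2 ^ 2 * arraySum M ΔT r₀ 4 ^ 2)

/-- The matrix `A_M`. -/
def matA (M : ℕ) (ΔT : ℝ) (r₀ : Space) : Matrix (Fin 2) (Fin 2) ℝ :=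
  let s := arraySum M ΔT r₀
  let sb := arraySumBar M ΔT r₀
  let z₀ := r₀ 2
  (1 / s 2 ^ 2) •
    !![(3 * z₀ ^ 2 * s 6 - 2 * s 4) * s 2 - sb 3 ^ 2, (s 4 * sb 3 + 3 * s 2 * sb 5) * z₀;
       (s 4 * sb 3 + 3 * sb 5 * s 2) * z₀, (s 4 - 3 * s 6 * z₀ ^ 2) * s 2 - (s 4 * z₀) ^ 2]

/-- The matrix `B_M`. -/
def matB (M : ℕ) (ΔT : ℝ) (r₀ : Space) : Matrix (Fin 2) (Fin 2) ℝ :=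
  let s := arraySum M ΔT r₀
  let sb := arraySumBar M ΔT r₀
  let z₀ := r₀ 2
  (1 / s 2 ^ 2) •
    !![s 2 ^ 2 - z₀ ^ 2 * s 2 * s 4 - sb 2 ^ 2, (sb 2 * s 3 - sb 3 * s 2) * z₀;
       (s 3 * sb 2 - sb 3 * s 2) * z₀, z₀ ^ 2 * (s 4 * s 2 - s 3 ^ 2)]

/-- The `2 × 2` block `M_M^{(2)} = A_M + (2π / λ)² B_M`. -/
def matM2 (lam : ℝ) (M : ℕ) (ΔT : ℝ) (r₀ : Space) : Matrix (Fin 2) (Fin 2) ℝ :=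
  matA M ΔT r₀ + (2 * Real.pi / lam) ^ 2 • matB M ΔT r₀

/-- The block-diagonal matrix `M_M = diag(γ_M^{(1)}, M_M^{(2)})`. -/
def matM (lam : ℝ) (M : ℕ) (ΔT : ℝ) (r₀ : Space) : Matrix (Fin 3) (Fin 3) ℝ :=
  let N := matM2 lam M ΔT r₀
  !![gammaOne M ΔT r₀, 0, 0;
     0, N 0 0, N 0 1;
     0, N 1 0, N 1 1]

end Beamfocusing

end

/-!
At a point `r₀` of the `yz`-plane the direction of every element is orthogonal to the `x`-axis.
An `x`-polarized signal therefore passes all projections unchanged, while any left singular vector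
with a component in the plane loses energy at some element, since two elements already see `r₀`
from different directions. So the dominant right singular vector is the matched filter
`w_{m,j} ∝ conj (h_m(r₀))` for the first polarization `j`, and zero for the others
(`IsMaxSingularPair.left_eq_zero`, `IsMaxSingularPair.right_eq`). Consequently (`snr_eq_meanPower`)
`SNR(r)` is a constant times
`‖mean_m d_m⁻¹ φ_m(r)‖² / s_M^{(2)}`, where `d_m = ‖r₀ - p_m‖` and `φ_m(r)` has amplitude
`1 / ‖r - p_m‖`, phase `-(2π / λ) (‖r - p_m‖ - d_m)` and polarization `(I - P_m(r)) e_x`.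

Along the segment from `r₀` to `r`, the inverse distance `p`, the radial speed `v`, the coordinates
`n_i` of the unit direction and the sine and cosine of the phase form a system closed under
differentiation (`p' = -p² v`, `v' = (‖δ‖² - v²) p`, `n_i' = (δ_i - n_i v) p`), with
`|p| ≤ 1 / ρ`, `|v| ≤ ‖δ‖`, `|n_i| ≤ 1`. Hence the derivatives of order `j ≤ 3` of `φ_m` are at most
`K ‖δ‖ ^ j` with `K` a polynomial in `1 / ρ` (`exists_isJet_rayField`). Taylor's formula for each
`φ_m`, averaged over the array, gives the square of every real component up to
`4 (mean_m d_m⁻¹)² K² ‖δ‖³`. As `(mean_m d_m⁻¹)² ≤ s_M^{(2)}`, the division by `s_M^{(2)}` is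
harmless and the bound does not depend on the array. The Taylor coefficients average to the sums
`s_M^{(k)}` and `s̄_M^{(k)}` through `(m Δ_T - y₀)² + z₀² = d_m²` (`exists_meanField_expansion`,
`abs_meanPower_sub_le`). The non-negativity of `γ_M^{(1)}` is the Cauchy-Schwarz inequality for
means over the array (`gammaOne_nonneg`).
-/

namespace Beamfocusing

/-! ### Three-times differentiable functions with controlled derivatives -/

/-- On `[0, 1]` the functions `f₁, f₂, f₃` are the first three derivatives of `f₀`, and the
`i`-th one is bounded by `K η ^ i`. Here `η` is the length of a displacement, so that the bounds
are homogeneous in it. -/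
structure IsJet (η K : ℝ) (f₀ f₁ f₂ f₃ : ℝ → ℝ) : Prop where
  deriv₀ : ∀ τ ∈ Set.Icc (0 : ℝ) 1, HasDerivAt f₀ (f₁ τ) τ
  deriv₁ : ∀ τ ∈ Set.Icc (0 : ℝ) 1, HasDerivAt f₁ (f₂ τ) τ
  deriv₂ : ∀ τ ∈ Set.Icc (0 : ℝ) 1, HasDerivAt f₂ (f₃ τ) τ
  bound₀ : ∀ τ ∈ Set.Icc (0 : ℝ) 1, |f₀ τ| ≤ K
  bound₁ : ∀ τ ∈ Set.Icc (0 : ℝ) 1, |f₁ τ| ≤ K * η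
  bound₂ : ∀ τ ∈ Set.Icc (0 : ℝ) 1, |f₂ τ| ≤ K * η ^ 2
  bound₃ : ∀ τ ∈ Set.Icc (0 : ℝ) 1, |f₃ τ| ≤ K * η ^ 3

theorem abs_mul_le_of_le {a b A B : ℝ} (ha : |a| ≤ A) (hb : |b| ≤ B) : |a * b| ≤ A * B := by
  rw [abs_mul]
  exact mul_le_mul ha hb (abs_nonneg _) ((abs_nonneg _).trans ha)

theorem abs_pow_le_of_le {a A : ℝ} (ha : |a| ≤ A) (n : ℕ) : |a ^ n| ≤ A ^ n := by
  rw [abs_pow]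
  exact pow_le_pow_left₀ (abs_nonneg _) ha n

namespace IsJet

variable {η K L : ℝ} {f₀ f₁ f₂ f₃ g₀ g₁ g₂ g₃ : ℝ → ℝ}

theorem nonneg (hf : IsJet η K f₀ f₁ f₂ f₃) : 0 ≤ K :=
  (abs_nonneg _).trans (hf.bound₀ 0 (by simp))

theorem const_sub {c : ℝ} (hc : |c| ≤ 1) (hη : 0 ≤ η) (hf : IsJet η K f₀ f₁ f₂ f₃) :
    IsJet η (1 + K) (fun τ => c - f₀ τ) (fun τ => -f₁ τ) (fun τ => -f₂ τ) (fun τ => -f₃ τ) where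
  deriv₀ τ hτ := (hf.deriv₀ τ hτ).const_sub c
  deriv₁ τ hτ := (hf.deriv₁ τ hτ).neg
  deriv₂ τ hτ := (hf.deriv₂ τ hτ).neg
  bound₀ τ hτ := (abs_sub _ _).trans (add_le_add hc (hf.bound₀ τ hτ))
  bound₁ τ hτ := by
    rw [abs_neg]
    exact (hf.bound₁ τ hτ).trans (by nlinarith)
  bound₂ τ hτ := by
    rw [abs_neg]
    exact (hf.bound₂ τ hτ).trans (by nlinarith [pow_nonneg hη 2])
  bound₃ τ hτ := by
    rw [abs_neg]
    exact (hf.bound₃ τ hτ).trans (by nlinarith [pow_nonneg hη 3])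

/-- The Leibniz rule up to order three. -/
theorem mul (hη : 0 ≤ η) (hf : IsJet η K f₀ f₁ f₂ f₃) (hg : IsJet η L g₀ g₁ g₂ g₃) :
    IsJet η (8 * (K * L)) (fun τ => f₀ τ * g₀ τ) (fun τ => f₁ τ * g₀ τ + f₀ τ * g₁ τ)
      (fun τ => f₂ τ * g₀ τ + 2 * (f₁ τ * g₁ τ) + f₀ τ * g₂ τ)
      (fun τ => f₃ τ * g₀ τ + 3 * (f₂ τ * g₁ τ) + 3 * (f₁ τ * g₂ τ) + f₀ τ * g₃ τ) := by
  have hK := hf.nonneg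
  have hL := hg.nonneg
  have hKL : 0 ≤ K * L := mul_nonneg hK hL
  refine ⟨fun τ hτ => (hf.deriv₀ τ hτ).mul (hg.deriv₀ τ hτ), fun τ hτ => ?_, fun τ hτ => ?_,
    fun τ hτ => ?_, fun τ hτ => ?_, fun τ hτ => ?_, fun τ hτ => ?_⟩
  · refine (((hf.deriv₁ τ hτ).mul (hg.deriv₀ τ hτ)).add
      ((hf.deriv₀ τ hτ).mul (hg.deriv₁ τ hτ))).congr_deriv ?_
    ring
  · refine ((((hf.deriv₂ τ hτ).mul (hg.deriv₀ τ hτ)).add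
      (((hf.deriv₁ τ hτ).mul (hg.deriv₁ τ hτ)).const_mul 2)).add
      ((hf.deriv₀ τ hτ).mul (hg.deriv₂ τ hτ))).congr_deriv ?_
    ring
  · exact (abs_mul_le_of_le (hf.bound₀ τ hτ) (hg.bound₀ τ hτ)).trans (by linarith)
  · have h1 := abs_mul_le_of_le (hf.bound₁ τ hτ) (hg.bound₀ τ hτ)
    have h2 := abs_mul_le_of_le (hf.bound₀ τ hτ) (hg.bound₁ τ hτ)
    have h := mul_nonneg hKL hη
    refine (abs_add_le _ _).trans ?_
    linarith
  · have h1 := abs_mul_le_of_le (hf.bound₂ τ hτ) (hg.bound₀ τ hτ)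
    have h2 := abs_mul_le_of_le (hf.bound₁ τ hτ) (hg.bound₁ τ hτ)
    have h3 := abs_mul_le_of_le (hf.bound₀ τ hτ) (hg.bound₂ τ hτ)
    have h := mul_nonneg hKL (pow_nonneg hη 2)
    rw [abs_le] at h1 h2 h3 ⊢
    constructor <;> linarith
  · have h1 := abs_mul_le_of_le (hf.bound₃ τ hτ) (hg.bound₀ τ hτ)
    have h2 := abs_mul_le_of_le (hf.bound₂ τ hτ) (hg.bound₁ τ hτ)
    have h3 := abs_mul_le_of_le (hf.bound₁ τ hτ) (hg.bound₂ τ hτ)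
    have h4 := abs_mul_le_of_le (hf.bound₀ τ hτ) (hg.bound₃ τ hτ)
    have h := mul_nonneg hKL (pow_nonneg hη 3)
    rw [abs_le] at h1 h2 h3 h4 ⊢
    constructor <;> linarith

end IsJet

/-- The mean value inequality on `[0, τ]`, for a bound that holds on all of `[0, 1]`. -/
theorem abs_sub_le_of_abs_deriv_le {f f' : ℝ → ℝ} {C : ℝ}
    (hf : ∀ τ ∈ Set.Icc (0 : ℝ) 1, HasDerivAt f (f' τ) τ)
    (hC : ∀ τ ∈ Set.Icc (0 : ℝ) 1, |f' τ| ≤ C) :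
    ∀ τ ∈ Set.Icc (0 : ℝ) 1, |f τ - f 0| ≤ C := by
  intro τ hτ
  have h := (convex_Icc (0 : ℝ) 1).norm_image_sub_le_of_norm_hasDerivWithin_le (f := f) (f' := f')
    (C := C) (fun x hx => (hf x hx).hasDerivWithinAt) hC
    (show (0 : ℝ) ∈ Set.Icc (0 : ℝ) 1 by simp) hτ
  have hC0 : 0 ≤ C := (abs_nonneg _).trans (hC 0 (by simp))
  rw [Real.norm_eq_abs, Real.norm_eq_abs, sub_zero, abs_of_nonneg hτ.1] at h
  exact h.trans (mul_le_of_le_one_right hC0 hτ.2)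

namespace IsJet

variable {η K : ℝ} {f₀ f₁ f₂ f₃ : ℝ → ℝ}

theorem taylor_one (hf : IsJet η K f₀ f₁ f₂ f₃) : |f₀ 1 - f₀ 0| ≤ K * η :=
  abs_sub_le_of_abs_deriv_le hf.deriv₀ hf.bound₁ 1 (by simp)

theorem taylor_two (hf : IsJet η K f₀ f₁ f₂ f₃) : |f₀ 1 - f₀ 0 - f₁ 0| ≤ K * η ^ 2 := by
  have h := abs_sub_le_of_abs_deriv_le (f := fun τ => f₀ τ - τ * f₁ 0)
    (f' := fun τ => f₁ τ - f₁ 0) (C := K * η ^ 2)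
    (fun τ hτ => by
      exact ((hf.deriv₀ τ hτ).sub ((hasDerivAt_id τ).mul_const (f₁ 0))).congr_deriv (by ring))
    (abs_sub_le_of_abs_deriv_le hf.deriv₁ hf.bound₂) 1 (by simp)
  calc _ = _ := by congr 1; ring
    _ ≤ _ := h

theorem taylor_three (hf : IsJet η K f₀ f₁ f₂ f₃) :
    |f₀ 1 - f₀ 0 - f₁ 0 - f₂ 0 / 2| ≤ K * η ^ 3 := by
  have h1 := abs_sub_le_of_abs_deriv_le (f := fun τ => f₁ τ - τ * f₂ 0)
    (f' := fun τ => f₂ τ - f₂ 0) (C := K * η ^ 3)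
    (fun τ hτ => by
      exact ((hf.deriv₁ τ hτ).sub ((hasDerivAt_id τ).mul_const (f₂ 0))).congr_deriv (by ring))
    (abs_sub_le_of_abs_deriv_le hf.deriv₂ hf.bound₃)
  have h := abs_sub_le_of_abs_deriv_le (f := fun τ => f₀ τ - τ * f₁ 0 - τ ^ 2 * (f₂ 0 / 2))
    (f' := fun τ => f₁ τ - τ * f₂ 0 - f₁ 0) (C := K * η ^ 3)
    (fun τ hτ => by
      refine (((hf.deriv₀ τ hτ).sub ((hasDerivAt_id τ).mul_const (f₁ 0))).sub
        ((hasDerivAt_pow 2 τ).mul_const (f₂ 0 / 2))).congr_deriv ?_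
      push_cast
      ring)
    (fun τ hτ => by simpa using h1 τ hτ) 1 (by simp)
  calc _ = _ := by congr 1; ring
    _ ≤ _ := h

end IsJet

/-! ### The field of one element along a segment -/

section Ray

variable (k β : ℝ) (i : Fin 3) (q δ : Space)

/-- Distance to the element after moving by `τ δ`, where `q` is the initial position relative to
the element. -/
noncomputable def rayDist (τ : ℝ) : ℝ := ‖q + τ • δ‖

/-- The radial speed: the derivative of `rayDist`. -/
noncomputable def raySpeed (τ : ℝ) : ℝ := (inner ℝ q δ + τ * ‖δ‖ ^ 2) / rayDist q δ τ

/-- A coordinate of the unit vector that points from the element to the moving point. -/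
noncomputable def rayDir (τ : ℝ) : ℝ := (q i + τ * δ i) / rayDist q δ τ

/-- The phase `k (‖q + τ δ‖ - ‖q‖)`, shifted by `β`. The shifts `0` and `-π / 2` make its cosine
the cosine and the sine of the unshifted phase. -/
noncomputable def rayPhase (τ : ℝ) : ℝ := k * (rayDist q δ τ - ‖q‖) + β

/-- Entry `(i, 0)` of the complementary projection of the element. -/
noncomputable def rayProj (τ : ℝ) : ℝ :=
  (if i = 0 then 1 else 0) - rayDir 0 q δ τ * rayDir i q δ τ

/-- The real field component: amplitude times cosine of the shifted phase times polarization. -/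
noncomputable def rayField (τ : ℝ) : ℝ :=
  (rayDist q δ τ)⁻¹ * Real.cos (rayPhase k β q δ τ) * rayProj i q δ τ

variable {k β i q δ}

theorem rayDist_sq (τ : ℝ) :
    rayDist q δ τ ^ 2 = ‖q‖ ^ 2 + 2 * τ * inner ℝ q δ + τ ^ 2 * ‖δ‖ ^ 2 := by
  rw [rayDist, norm_add_sq_real, inner_smul_right, norm_smul, mul_pow, Real.norm_eq_abs, sq_abs]
  ring

theorem hasDerivAt_rayDist {τ : ℝ} (h : 0 < rayDist q δ τ) :
    HasDerivAt (rayDist q δ) (raySpeed q δ τ) τ := by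
  have h1 : HasDerivAt (fun t : ℝ => ‖q‖ ^ 2 + 2 * t * inner ℝ q δ + t ^ 2 * ‖δ‖ ^ 2)
      (2 * inner ℝ q δ + 2 * τ * ‖δ‖ ^ 2) τ := by
    refine ((((hasDerivAt_id τ).const_mul 2).mul_const (inner ℝ q δ)).const_add (‖q‖ ^ 2)).add
      ((hasDerivAt_pow 2 τ).mul_const (‖δ‖ ^ 2)) |>.congr_deriv ?_
    push_cast
    ring
  have h2 := h1.sqrt (by rw [← rayDist_sq]; positivity)
  rw [← rayDist_sq, Real.sqrt_sq h.le] at h2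
  refine (h2.congr_deriv ?_).congr_of_eventuallyEq (.of_forall fun t => ?_)
  · rw [raySpeed]
    field_simp
  · dsimp only
    rw [← rayDist_sq, Real.sqrt_sq (show 0 ≤ rayDist q δ t from norm_nonneg _)]

theorem hasDerivAt_rayDist_inv {τ : ℝ} (h : 0 < rayDist q δ τ) :
    HasDerivAt (fun τ => (rayDist q δ τ)⁻¹)
      (-((rayDist q δ τ)⁻¹ ^ 2 * raySpeed q δ τ)) τ := by
  refine ((hasDerivAt_rayDist h).inv h.ne').congr_deriv ?_
  field_simp

theorem hasDerivAt_raySpeed {τ : ℝ} (h : 0 < rayDist q δ τ) :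
    HasDerivAt (raySpeed q δ)
      ((‖δ‖ ^ 2 - raySpeed q δ τ ^ 2) * (rayDist q δ τ)⁻¹) τ := by
  refine ((((hasDerivAt_id τ).mul_const (‖δ‖ ^ 2)).const_add (inner ℝ q δ)).div
    (hasDerivAt_rayDist h) h.ne').congr_deriv ?_
  simp only [id, raySpeed]
  field_simp

theorem hasDerivAt_rayDir {τ : ℝ} (h : 0 < rayDist q δ τ) :
    HasDerivAt (rayDir i q δ)
      ((δ i - rayDir i q δ τ * raySpeed q δ τ) * (rayDist q δ τ)⁻¹) τ := by
  refine ((((hasDerivAt_id τ).mul_const (δ i)).const_add (q i)).div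
    (hasDerivAt_rayDist h) h.ne').congr_deriv ?_
  simp only [id, rayDir]
  field_simp

theorem hasDerivAt_rayPhase {τ : ℝ} (h : 0 < rayDist q δ τ) :
    HasDerivAt (rayPhase k β q δ) (k * raySpeed q δ τ) τ :=
  (((hasDerivAt_rayDist h).sub_const ‖q‖).const_mul k).add_const β

theorem abs_raySpeed_le (τ : ℝ) : |raySpeed q δ τ| ≤ ‖δ‖ := by
  have h : inner ℝ q δ + τ * ‖δ‖ ^ 2 = inner ℝ (q + τ • δ) δ := by
    rw [inner_add_left, real_inner_smul_left, real_inner_self_eq_norm_sq]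
  rw [raySpeed, h, abs_div, rayDist, abs_norm]
  exact div_le_of_le_mul₀ (norm_nonneg _) (norm_nonneg _)
    ((abs_real_inner_le_norm _ _).trans_eq (mul_comm _ _))

theorem abs_rayDir_le (τ : ℝ) : |rayDir i q δ τ| ≤ 1 := by
  rw [rayDir, abs_div, rayDist, abs_norm]
  refine div_le_one_of_le₀ ?_ (norm_nonneg _)
  simpa using PiLp.norm_apply_le (q + τ • δ) i

variable {ρ : ℝ}

theorem abs_rayDist_inv_le (hρ : 0 < ρ) {τ : ℝ} (h : ρ ≤ rayDist q δ τ) :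
    |(rayDist q δ τ)⁻¹| ≤ 1 / ρ := by
  rw [abs_of_pos (inv_pos.2 (hρ.trans_le h)), ← one_div]
  exact one_div_le_one_div_of_le hρ h

theorem abs_sq_sub_raySpeed_sq_le (τ : ℝ) : |‖δ‖ ^ 2 - raySpeed q δ τ ^ 2| ≤ ‖δ‖ ^ 2 := by
  have h := abs_pow_le_of_le (abs_raySpeed_le (q := q) (δ := δ) τ) 2
  rw [abs_of_nonneg (sq_nonneg _)] at h
  rw [abs_le]
  constructor <;> nlinarith [sq_nonneg (raySpeed q δ τ), sq_nonneg ‖δ‖]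

theorem pow_le_one_add_pow {x : ℝ} (hx : 0 ≤ x) {m n : ℕ} (h : m ≤ n) : x ^ m ≤ (1 + x) ^ n :=
  (pow_le_pow_left₀ hx (by linarith) m).trans (pow_le_pow_right₀ (by linarith) h)

theorem isJet_rayDist_inv (hρ : 0 < ρ) (hD : ∀ τ ∈ Set.Icc (0 : ℝ) 1, ρ ≤ rayDist q δ τ) :
    IsJet ‖δ‖ (24 * (1 + 1 / ρ) ^ 4) (fun τ => (rayDist q δ τ)⁻¹)
      (fun τ => -((rayDist q δ τ)⁻¹ ^ 2 * raySpeed q δ τ))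
      (fun τ => (rayDist q δ τ)⁻¹ ^ 3 * (3 * raySpeed q δ τ ^ 2 - ‖δ‖ ^ 2))
      (fun τ => (rayDist q δ τ)⁻¹ ^ 4 *
        (9 * (raySpeed q δ τ * ‖δ‖ ^ 2) - 15 * raySpeed q δ τ ^ 3)) := by
  have pos : ∀ τ ∈ Set.Icc (0 : ℝ) 1, 0 < rayDist q δ τ := fun τ hτ => hρ.trans_le (hD τ hτ)
  have hx : 0 ≤ 1 / ρ := by positivity
  have hp := fun τ hτ => abs_rayDist_inv_le hρ (hD τ hτ)
  have hv := fun τ => abs_raySpeed_le (q := q) (δ := δ) τ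
  refine ⟨fun τ hτ => hasDerivAt_rayDist_inv (pos τ hτ), fun τ hτ => ?_, fun τ hτ => ?_,
    fun τ hτ => ?_, fun τ hτ => ?_, fun τ hτ => ?_, fun τ hτ => ?_⟩
  · refine ((((hasDerivAt_rayDist_inv (pos τ hτ)).fun_pow 2).mul
      (hasDerivAt_raySpeed (pos τ hτ))).neg).congr_deriv ?_
    push_cast
    ring
  · refine (((hasDerivAt_rayDist_inv (pos τ hτ)).fun_pow 3).mul
      ((((hasDerivAt_raySpeed (pos τ hτ)).fun_pow 2).const_mul 3).sub_const (‖δ‖ ^ 2))).congr_deriv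
        ?_
    push_cast
    ring
  · refine (hp τ hτ).trans ?_
    have := pow_le_one_add_pow hx (show 1 ≤ 4 by norm_num)
    have : 0 ≤ (1 + 1 / ρ) ^ 4 := by positivity
    linarith
  · rw [abs_neg]
    refine (abs_mul_le_of_le (abs_pow_le_of_le (hp τ hτ) 2) (hv τ)).trans ?_
    have := pow_le_one_add_pow hx (show 2 ≤ 4 by norm_num)
    gcongr
    have : 0 ≤ (1 + 1 / ρ) ^ 4 := by positivity
    linarith
  · have h : |3 * raySpeed q δ τ ^ 2 - ‖δ‖ ^ 2| ≤ 24 * ‖δ‖ ^ 2 := by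
      have h1 := abs_pow_le_of_le (hv τ) 2
      have h2 := sq_nonneg ‖δ‖
      rw [abs_le] at h1 ⊢
      constructor <;> linarith
    refine (abs_mul_le_of_le (abs_pow_le_of_le (hp τ hτ) 3) h).trans ?_
    rw [← mul_assoc, mul_comm _ (24 : ℝ)]
    gcongr
    exact pow_le_one_add_pow hx (by norm_num)
  · have h : |9 * (raySpeed q δ τ * ‖δ‖ ^ 2) - 15 * raySpeed q δ τ ^ 3| ≤ 24 * ‖δ‖ ^ 3 := by
      have h1 := abs_pow_le_of_le (hv τ) 3
      have h2 := abs_mul_le_of_le (hv τ) (abs_pow_le_of_le (abs_norm δ).le 2)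
      rw [abs_le] at h1 h2 ⊢
      constructor <;> linarith
    refine (abs_mul_le_of_le (abs_pow_le_of_le (hp τ hτ) 4) h).trans ?_
    rw [← mul_assoc, mul_comm _ (24 : ℝ)]
    gcongr
    linarith

theorem isJet_rayDir (hρ : 0 < ρ) (hD : ∀ τ ∈ Set.Icc (0 : ℝ) 1, ρ ≤ rayDist q δ τ) :
    IsJet ‖δ‖ (36 * (1 + 1 / ρ) ^ 3) (rayDir i q δ)
      (fun τ => (δ i - rayDir i q δ τ * raySpeed q δ τ) * (rayDist q δ τ)⁻¹)
      (fun τ => (rayDist q δ τ)⁻¹ ^ 2 * (3 * (rayDir i q δ τ * raySpeed q δ τ ^ 2)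
        - 2 * (δ i * raySpeed q δ τ) - rayDir i q δ τ * ‖δ‖ ^ 2))
      (fun τ => (rayDist q δ τ)⁻¹ ^ 3 * (-15 * (rayDir i q δ τ * raySpeed q δ τ ^ 3)
        + 9 * (δ i * raySpeed q δ τ ^ 2) + 9 * (rayDir i q δ τ * (raySpeed q δ τ * ‖δ‖ ^ 2))
        - 3 * (δ i * ‖δ‖ ^ 2))) := by
  have pos : ∀ τ ∈ Set.Icc (0 : ℝ) 1, 0 < rayDist q δ τ := fun τ hτ => hρ.trans_le (hD τ hτ)
  have hx : 0 ≤ 1 / ρ := by positivity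
  have hp := fun τ hτ => abs_rayDist_inv_le hρ (hD τ hτ)
  have hv := fun τ => abs_raySpeed_le (q := q) (δ := δ) τ
  have hn := fun τ => abs_rayDir_le (i := i) (q := q) (δ := δ) τ
  have hδ : |δ i| ≤ ‖δ‖ := PiLp.norm_apply_le δ i
  have hη := abs_pow_le_of_le (abs_norm δ).le 2
  refine ⟨fun τ hτ => hasDerivAt_rayDir (pos τ hτ), fun τ hτ => ?_, fun τ hτ => ?_,
    fun τ hτ => ?_, fun τ hτ => ?_, fun τ hτ => ?_, fun τ hτ => ?_⟩
  · refine ((((hasDerivAt_rayDir (pos τ hτ)).fun_mul (hasDerivAt_raySpeed (pos τ hτ))).const_sub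
      (δ i)).mul (hasDerivAt_rayDist_inv (pos τ hτ))).congr_deriv ?_
    ring
  · have dn := hasDerivAt_rayDir (i := i) (pos τ hτ)
    have dv := hasDerivAt_raySpeed (pos τ hτ)
    refine (((hasDerivAt_rayDist_inv (pos τ hτ)).fun_pow 2).mul
      ((((dn.fun_mul (dv.fun_pow 2)).const_mul 3).fun_sub ((dv.const_mul (δ i)).const_mul 2)).fun_sub
        (dn.mul_const (‖δ‖ ^ 2)))).congr_deriv ?_
    push_cast
    ring
  · refine (hn τ).trans ?_
    have := one_le_pow₀ (show 1 ≤ 1 + 1 / ρ by linarith) (n := 3)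
    linarith
  · have h : |δ i - rayDir i q δ τ * raySpeed q δ τ| ≤ 36 * ‖δ‖ := by
      have h1 := abs_mul_le_of_le (hn τ) (hv τ)
      have h2 := norm_nonneg δ
      rw [abs_le] at h1 hδ ⊢
      constructor <;> linarith
    refine (abs_mul_le_of_le h (hp τ hτ)).trans ?_
    rw [mul_right_comm]
    gcongr
    simpa using pow_le_one_add_pow hx (show 1 ≤ 3 by norm_num)
  · have h : |3 * (rayDir i q δ τ * raySpeed q δ τ ^ 2)
        - 2 * (δ i * raySpeed q δ τ) - rayDir i q δ τ * ‖δ‖ ^ 2| ≤ 36 * ‖δ‖ ^ 2 := by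
      have h1 := abs_mul_le_of_le (hn τ) (abs_pow_le_of_le (hv τ) 2)
      have h2 := abs_mul_le_of_le hδ (hv τ)
      have h3 := abs_mul_le_of_le (hn τ) hη
      have h4 := sq_nonneg ‖δ‖
      rw [abs_le] at h1 h2 h3 ⊢
      constructor <;> linarith
    refine (abs_mul_le_of_le (abs_pow_le_of_le (hp τ hτ) 2) h).trans ?_
    rw [← mul_assoc, mul_comm _ (36 : ℝ)]
    gcongr
    exact pow_le_one_add_pow hx (by norm_num)
  · have h : |-15 * (rayDir i q δ τ * raySpeed q δ τ ^ 3)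
        + 9 * (δ i * raySpeed q δ τ ^ 2) + 9 * (rayDir i q δ τ * (raySpeed q δ τ * ‖δ‖ ^ 2))
        - 3 * (δ i * ‖δ‖ ^ 2)| ≤ 36 * ‖δ‖ ^ 3 := by
      have h1 := abs_mul_le_of_le (hn τ) (abs_pow_le_of_le (hv τ) 3)
      have h2 := abs_mul_le_of_le hδ (abs_pow_le_of_le (hv τ) 2)
      have h3 := abs_mul_le_of_le (hn τ) (abs_mul_le_of_le (hv τ) hη)
      have h4 := abs_mul_le_of_le hδ hη
      rw [abs_le] at h1 h2 h3 h4 ⊢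
      constructor <;> linarith
    refine (abs_mul_le_of_le (abs_pow_le_of_le (hp τ hτ) 3) h).trans ?_
    rw [← mul_assoc, mul_comm _ (36 : ℝ)]
    gcongr
    linarith

theorem isJet_cos_rayPhase (hk : 0 ≤ k) (hρ : 0 < ρ)
    (hD : ∀ τ ∈ Set.Icc (0 : ℝ) 1, ρ ≤ rayDist q δ τ) :
    IsJet ‖δ‖ (3 * ((1 + k) ^ 3 * (1 + 1 / ρ) ^ 2)) (fun τ => Real.cos (rayPhase k β q δ τ))
      (fun τ => -(k * (raySpeed q δ τ * Real.sin (rayPhase k β q δ τ))))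
      (fun τ => -(k * ((rayDist q δ τ)⁻¹ * ((‖δ‖ ^ 2 - raySpeed q δ τ ^ 2) *
          Real.sin (rayPhase k β q δ τ))))
        - k ^ 2 * (raySpeed q δ τ ^ 2 * Real.cos (rayPhase k β q δ τ)))
      (fun τ => 3 * k * ((rayDist q δ τ)⁻¹ ^ 2 * (raySpeed q δ τ *
          ((‖δ‖ ^ 2 - raySpeed q δ τ ^ 2) * Real.sin (rayPhase k β q δ τ))))
        - 3 * k ^ 2 * ((rayDist q δ τ)⁻¹ * (raySpeed q δ τ *
          ((‖δ‖ ^ 2 - raySpeed q δ τ ^ 2) * Real.cos (rayPhase k β q δ τ))))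
        + k ^ 3 * (raySpeed q δ τ ^ 3 * Real.sin (rayPhase k β q δ τ))) := by
  have pos : ∀ τ ∈ Set.Icc (0 : ℝ) 1, 0 < rayDist q δ τ := fun τ hτ => hρ.trans_le (hD τ hτ)
  have hx : 0 ≤ 1 / ρ := by positivity
  have hp := fun τ hτ => abs_rayDist_inv_le hρ (hD τ hτ)
  have hv := fun τ => abs_raySpeed_le (q := q) (δ := δ) τ
  have ha := fun τ => abs_sq_sub_raySpeed_sq_le (q := q) (δ := δ) τ
  have hs := fun τ => Real.abs_sin_le_one (rayPhase k β q δ τ)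
  have hc := fun τ => Real.abs_cos_le_one (rayPhase k β q δ τ)
  refine ⟨fun τ hτ => ?_, fun τ hτ => ?_, fun τ hτ => ?_,
    fun τ hτ => ?_, fun τ hτ => ?_, fun τ hτ => ?_, fun τ hτ => ?_⟩
  · refine (hasDerivAt_rayPhase (pos τ hτ)).cos.congr_deriv ?_
    ring
  · refine ((((hasDerivAt_raySpeed (pos τ hτ)).mul
      (hasDerivAt_rayPhase (pos τ hτ)).sin).const_mul k).neg).congr_deriv ?_
    ring
  · have dv := hasDerivAt_raySpeed (pos τ hτ)
    have dp := hasDerivAt_rayDist_inv (pos τ hτ)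
    have dt := hasDerivAt_rayPhase (k := k) (β := β) (pos τ hτ)
    refine (((dp.fun_mul (((dv.fun_pow 2).const_sub (‖δ‖ ^ 2)).fun_mul dt.sin)).const_mul k).neg.sub
      (((dv.fun_pow 2).mul dt.cos).const_mul (k ^ 2))).congr_deriv ?_
    push_cast
    ring
  · refine (hc τ).trans ?_
    have h1 := one_le_pow₀ (show 1 ≤ 1 + 1 / ρ by linarith) (n := 2)
    have h2 := one_le_pow₀ (show 1 ≤ 1 + k by linarith) (n := 3)
    nlinarith
  · have h := abs_mul_le_of_le (hv τ) (hs τ)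
    rw [abs_neg, abs_mul, abs_of_nonneg hk]
    refine (mul_le_mul_of_nonneg_left h hk).trans ?_
    rw [mul_one]
    gcongr
    generalize 1 / ρ = x at *
    rw [← sub_nonneg]
    ring_nf
    positivity
  · have h1 := abs_mul_le_of_le (hp τ hτ) (abs_mul_le_of_le (ha τ) (hs τ))
    have h2 := abs_mul_le_of_le (abs_pow_le_of_le (hv τ) 2) (hc τ)
    generalize 1 / ρ = x at *
    have h : k * (x * (‖δ‖ ^ 2 * 1)) + k ^ 2 * (‖δ‖ ^ 2 * 1) ≤
        3 * ((1 + k) ^ 3 * (1 + x) ^ 2) * ‖δ‖ ^ 2 := by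
      rw [← sub_nonneg]
      ring_nf
      positivity
    refine (abs_sub _ _).trans (le_trans ?_ h)
    rw [abs_neg, abs_mul k, abs_mul (k ^ 2), abs_of_nonneg hk, abs_of_nonneg (pow_nonneg hk 2)]
    gcongr
  · have h1 := abs_mul_le_of_le (abs_pow_le_of_le (hp τ hτ) 2)
      (abs_mul_le_of_le (hv τ) (abs_mul_le_of_le (ha τ) (hs τ)))
    have h2 := abs_mul_le_of_le (hp τ hτ)
      (abs_mul_le_of_le (hv τ) (abs_mul_le_of_le (ha τ) (hc τ)))
    have h3 := abs_mul_le_of_le (abs_pow_le_of_le (hv τ) 3) (hs τ)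
    generalize 1 / ρ = x at *
    have h : 3 * k * (x ^ 2 * (‖δ‖ * (‖δ‖ ^ 2 * 1))) + 3 * k ^ 2 * (x * (‖δ‖ * (‖δ‖ ^ 2 * 1))) +
        k ^ 3 * (‖δ‖ ^ 3 * 1) ≤ 3 * ((1 + k) ^ 3 * (1 + x) ^ 2) * ‖δ‖ ^ 3 := by
      rw [← sub_nonneg]
      ring_nf
      positivity
    refine (abs_add_le _ _).trans (le_trans (add_le_add_left (abs_sub _ _) _) (le_trans ?_ h))
    rw [abs_mul (3 * k), abs_mul (3 * k ^ 2), abs_mul (k ^ 3),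
      abs_of_nonneg (show 0 ≤ 3 * k by positivity), abs_of_nonneg (show 0 ≤ 3 * k ^ 2 by positivity),
      abs_of_nonneg (pow_nonneg hk 3)]
    gcongr

/-- The bound `K` of the field components as a function of `x = 1 / ρ` and of the wave number. -/
noncomputable def fieldBound (k : ℝ) : Polynomial ℝ :=
  let X : Polynomial ℝ := 1 + Polynomial.X
  8 * (8 * (24 * X ^ 4 * (3 * (Polynomial.C ((1 + k) ^ 3) * X ^ 2))) *
    (1 + 8 * (36 * X ^ 3 * (36 * X ^ 3))))

/-- The field component of an element whose initial direction is orthogonal to the first axis: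
its derivatives are bounded, and its value and first two derivatives at the start are explicit.
Orthogonality makes the polarization factor stationary at the start. -/
theorem exists_isJet_rayField (hk : 0 ≤ k) (hρ : 0 < ρ)
    (hD : ∀ τ ∈ Set.Icc (0 : ℝ) 1, ρ ≤ rayDist q δ τ) (hq : q 0 = 0) :
    ∃ f₁ f₂ f₃, IsJet ‖δ‖ ((fieldBound k).eval (1 / ρ)) (rayField k β i q δ) f₁ f₂ f₃ ∧
      rayField k β i q δ 0 = ‖q‖⁻¹ * Real.cos β * (if i = 0 then 1 else 0) ∧
      f₁ 0 = (-(‖q‖⁻¹ ^ 3 * inner ℝ q δ) * Real.cos β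
        - k * ‖q‖⁻¹ ^ 2 * inner ℝ q δ * Real.sin β) * (if i = 0 then 1 else 0)
        - ‖q‖⁻¹ ^ 3 * Real.cos β * δ 0 * q i ∧
      (i = 0 → β = 0 → f₂ 0 = ‖q‖⁻¹ ^ 5 * 3 * inner ℝ q δ ^ 2 - ‖q‖⁻¹ ^ 3 * ‖δ‖ ^ 2
        - k ^ 2 * ‖q‖⁻¹ ^ 3 * inner ℝ q δ ^ 2 - 2 * ‖q‖⁻¹ ^ 3 * δ 0 ^ 2) := by
  have hη := norm_nonneg δ
  have J := ((isJet_rayDist_inv hρ hD).mul hη (isJet_cos_rayPhase (β := β) hk hρ hD)).mul hη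
    (((isJet_rayDir (i := 0) hρ hD).mul hη (isJet_rayDir (i := i) hρ hD)).const_sub
      (c := if i = 0 then 1 else 0) (by split_ifs <;> simp) hη)
  have hd : rayDist q δ 0 = ‖q‖ := by simp [rayDist]
  have hn : ∀ j, rayDir j q δ 0 = q j * ‖q‖⁻¹ := fun j => by simp [rayDir, hd, div_eq_mul_inv]
  have hv : raySpeed q δ 0 = inner ℝ q δ * ‖q‖⁻¹ := by simp [raySpeed, hd, div_eq_mul_inv]
  have hθ : rayPhase k β q δ 0 = β := by simp [rayPhase, hd]
  have hK : (fieldBound k).eval (1 / ρ) = 8 * (8 * (24 * (1 + 1 / ρ) ^ 4 *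
      (3 * ((1 + k) ^ 3 * (1 + 1 / ρ) ^ 2))) *
      (1 + 8 * (36 * (1 + 1 / ρ) ^ 3 * (36 * (1 + 1 / ρ) ^ 3)))) := by
    simp [fieldBound]
  rw [hK]
  refine ⟨_, _, _, J, ?_, ?_, ?_⟩
  · simp [rayField, rayProj, hd, hn, hq, hθ]
  · simp only [hd, hn, hv, hθ, hq]
    ring
  · rintro rfl rfl
    simp only [hd, hn, hv, hθ, hq, Real.cos_zero, Real.sin_zero, if_true]
    ring

end Ray

/-! ### Means over the array -/

/-- The mean of a quantity over the elements of the array. -/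
noncomputable def arrayMean (M : ℕ) (f : ℤ → ℝ) : ℝ :=
  1 / (2 * (M : ℝ) + 1) * ∑ m ∈ Finset.Icc (-(M : ℤ)) (M : ℤ), f m

section ArrayMean

variable {M : ℕ} {f g : ℤ → ℝ}

theorem arrayMean_congr (h : ∀ m ∈ Finset.Icc (-(M : ℤ)) (M : ℤ), f m = g m) :
    arrayMean M f = arrayMean M g := by
  rw [arrayMean, Finset.sum_congr rfl h, arrayMean]

theorem arrayMean_add : arrayMean M (fun m => f m + g m) = arrayMean M f + arrayMean M g := by
  simp only [arrayMean, Finset.sum_add_distrib, mul_add]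

theorem arrayMean_sub : arrayMean M (fun m => f m - g m) = arrayMean M f - arrayMean M g := by
  simp only [arrayMean, Finset.sum_sub_distrib, mul_sub]

theorem arrayMean_const_mul (c : ℝ) : arrayMean M (fun m => c * f m) = c * arrayMean M f := by
  simp only [arrayMean, ← Finset.mul_sum]
  ring

theorem arrayMean_neg : arrayMean M (fun m => -f m) = -arrayMean M f := by
  simp only [arrayMean, Finset.sum_neg_distrib, mul_neg]

theorem arrayMean_zero : arrayMean M (fun _ => 0) = 0 := by
  simp [arrayMean]

theorem arrayMean_one : arrayMean M (fun _ => 1) = 1 := by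
  have : (2 * (M : ℝ) + 1) ≠ 0 := by positivity
  have hc : (((M : ℤ) + 1 - -(M : ℤ)).toNat : ℝ) = 2 * (M : ℝ) + 1 := by
    rw [show (M : ℤ) + 1 - -(M : ℤ) = ((2 * M + 1 : ℕ) : ℤ) by push_cast; ring,
      Int.toNat_natCast]
    push_cast
    rfl
  rw [arrayMean, Finset.sum_const, Int.card_Icc, nsmul_eq_mul, mul_one, hc]
  field_simp

theorem abs_arrayMean_le (h : ∀ m ∈ Finset.Icc (-(M : ℤ)) (M : ℤ), |f m| ≤ g m) :
    |arrayMean M f| ≤ arrayMean M g := by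
  have hN : 0 ≤ 1 / (2 * (M : ℝ) + 1) := by positivity
  rw [arrayMean, arrayMean, abs_mul, abs_of_nonneg hN]
  exact mul_le_mul_of_nonneg_left
    ((Finset.abs_sum_le_sum_abs _ _).trans (Finset.sum_le_sum h)) hN

/-- The Cauchy-Schwarz inequality. -/
theorem arrayMean_mul_sq_le : arrayMean M (fun m => f m * g m) ^ 2 ≤
    arrayMean M (fun m => f m ^ 2) * arrayMean M (fun m => g m ^ 2) := by
  have h := Finset.sum_mul_sq_le_sq_mul_sq (Finset.Icc (-(M : ℤ)) (M : ℤ)) f g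
  simp only [arrayMean]
  calc _ = (1 / (2 * (M : ℝ) + 1)) ^ 2 *
        (∑ m ∈ Finset.Icc (-(M : ℤ)) (M : ℤ), f m * g m) ^ 2 := by ring
    _ ≤ (1 / (2 * (M : ℝ) + 1)) ^ 2 * ((∑ m ∈ Finset.Icc (-(M : ℤ)) (M : ℤ), f m ^ 2) *
        ∑ m ∈ Finset.Icc (-(M : ℤ)) (M : ℤ), g m ^ 2) := by gcongr
    _ = _ := by ring

end ArrayMean

section Geometry

variable {M : ℕ} {ΔT : ℝ} {m : ℤ} {r₀ : Space}

theorem arraySum_eq_arrayMean (k : ℕ) :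
    arraySum M ΔT r₀ k = arrayMean M (fun m => ‖r₀ - elementPos ΔT m‖⁻¹ ^ k) := by
  simp only [arraySum, arrayMean, one_div, inv_pow]

theorem arraySumBar_eq_arrayMean (k : ℕ) : arraySumBar M ΔT r₀ k =
    arrayMean M (fun m => ((m : ℝ) * ΔT - r₀ 1) * ‖r₀ - elementPos ΔT m‖⁻¹ ^ (k + 1)) := by
  simp only [arraySumBar, arrayMean, inv_pow, div_eq_mul_inv]

theorem sub_elementPos_zero (r : Space) : (r - elementPos ΔT m) 0 = r 0 := by
  simp [elementPos]

theorem sub_elementPos_one (r : Space) : (r - elementPos ΔT m) 1 = r 1 - m * ΔT := by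
  simp [elementPos]

theorem sub_elementPos_two (r : Space) : (r - elementPos ΔT m) 2 = r 2 := by
  simp [elementPos]

theorem norm_sub_elementPos_sq (hx : r₀ 0 = 0) :
    ‖r₀ - elementPos ΔT m‖ ^ 2 = ((m : ℝ) * ΔT - r₀ 1) ^ 2 + r₀ 2 ^ 2 := by
  rw [EuclideanSpace.real_norm_sq_eq, Fin.sum_univ_three, sub_elementPos_zero, sub_elementPos_one,
    sub_elementPos_two, hx]
  ring

theorem norm_sub_elementPos_pos (hz : r₀ 2 ≠ 0) : 0 < ‖r₀ - elementPos ΔT m‖ := by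
  refine norm_pos_iff.2 fun h => hz ?_
  rw [← sub_elementPos_two (ΔT := ΔT) (m := m), h]
  rfl

/-- The relation `(m Δ_T - y₀)² + z₀² = ‖r₀ - p_m‖²`, in terms of the inverse distance. -/
theorem sq_mul_inv_norm_sq (hx : r₀ 0 = 0) (hz : r₀ 2 ≠ 0) (k : ℕ) :
    ((m : ℝ) * ΔT - r₀ 1) ^ 2 * ‖r₀ - elementPos ΔT m‖⁻¹ ^ (k + 2) =
      ‖r₀ - elementPos ΔT m‖⁻¹ ^ k - r₀ 2 ^ 2 * ‖r₀ - elementPos ΔT m‖⁻¹ ^ (k + 2) := by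
  have h := norm_sub_elementPos_sq (ΔT := ΔT) (m := m) hx
  have hp := (norm_sub_elementPos_pos (ΔT := ΔT) (m := m) hz).ne'
  rw [eq_sub_iff_add_eq, ← add_mul, ← h, pow_add]
  field_simp

theorem inner_sub_elementPos (hx : r₀ 0 = 0) (δ : Space) :
    inner ℝ (r₀ - elementPos ΔT m) δ = r₀ 2 * δ 2 - ((m : ℝ) * ΔT - r₀ 1) * δ 1 := by
  rw [PiLp.inner_apply, Fin.sum_univ_three, sub_elementPos_zero, sub_elementPos_one,
    sub_elementPos_two, hx]
  simp
  ring

theorem arraySum_pos (hz : r₀ 2 ≠ 0) (k : ℕ) : 0 < arraySum M ΔT r₀ k := by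
  refine mul_pos (by positivity) (Finset.sum_pos (fun m _ => ?_) ⟨0, by simp⟩)
  have := norm_sub_elementPos_pos (ΔT := ΔT) (m := m) hz
  positivity

/-- Non-negativity of `γ_M^{(1)}`: with `Y_m = m Δ_T - y₀` and `d_m = ‖r₀ - p_m‖`, bound the means
of `d_m⁻¹ · Y_m d_m⁻³` and `d_m⁻¹ · d_m⁻³` by Cauchy-Schwarz and use `Y_m² + z₀² = d_m²`. -/
theorem gammaOne_nonneg (hx : r₀ 0 = 0) (hz : r₀ 2 ≠ 0) : 0 ≤ gammaOne M ΔT r₀ := by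
  have h1 : arraySumBar M ΔT r₀ 3 ^ 2 ≤ arraySum M ΔT r₀ 2 *
      (arraySum M ΔT r₀ 4 - r₀ 2 ^ 2 * arraySum M ΔT r₀ 6) := by
    have h := arrayMean_mul_sq_le (M := M) (f := fun m => ‖r₀ - elementPos ΔT m‖⁻¹)
      (g := fun m => ((m : ℝ) * ΔT - r₀ 1) * ‖r₀ - elementPos ΔT m‖⁻¹ ^ 3)
    have e : arraySum M ΔT r₀ 4 - r₀ 2 ^ 2 * arraySum M ΔT r₀ 6 =
        arrayMean M fun m => (((m : ℝ) * ΔT - r₀ 1) * ‖r₀ - elementPos ΔT m‖⁻¹ ^ 3) ^ 2 := by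
      simp only [arraySum_eq_arrayMean, ← arrayMean_const_mul, ← arrayMean_sub]
      refine arrayMean_congr fun m _ => ?_
      rw [← sq_mul_inv_norm_sq hx hz]
      ring
    rw [e, arraySum_eq_arrayMean, arraySumBar_eq_arrayMean]
    convert h using 3
    funext m
    ring
  have h2 : arraySum M ΔT r₀ 4 ^ 2 ≤ arraySum M ΔT r₀ 2 * arraySum M ΔT r₀ 6 := by
    have h := arrayMean_mul_sq_le (M := M) (f := fun m => ‖r₀ - elementPos ΔT m‖⁻¹)
      (g := fun m => ‖r₀ - elementPos ΔT m‖⁻¹ ^ 3)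
    simp only [arraySum_eq_arrayMean]
    convert h using 3
    all_goals
      funext m
      ring
  have h3 := mul_le_mul_of_nonneg_left h2 (sq_nonneg (r₀ 2))
  have h4 := mul_pos (arraySum_pos (M := M) (ΔT := ΔT) hz 2)
    (arraySum_pos (M := M) (ΔT := ΔT) hz 4)
  refine mul_nonneg (by positivity) ?_
  nlinarith

theorem arraySum_one_sq_le : arraySum M ΔT r₀ 1 ^ 2 ≤ arraySum M ΔT r₀ 2 := by
  have h := arrayMean_mul_sq_le (M := M) (f := fun m => ‖r₀ - elementPos ΔT m‖⁻¹)
    (g := fun _ => 1)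
  simpa [arraySum_eq_arrayMean, arrayMean_one] using h

end Geometry

/-! ### Expansion of the received power -/

/-- The mean field component at `r₀ + τ δ`: `rayField` averaged over the array with the weights
`‖r₀ - p_m‖⁻¹` of the matched filter at `r₀`. -/
noncomputable def meanField (k : ℝ) (M : ℕ) (ΔT : ℝ) (r₀ : Space) (β : ℝ) (i : Fin 3) (δ : Space)
    (τ : ℝ) : ℝ :=
  arrayMean M fun m =>
    ‖r₀ - elementPos ΔT m‖⁻¹ * rayField k β i (r₀ - elementPos ΔT m) δ τ

/-- Second-order expansion of a square with a remainder that is cubic for every `η ≥ 0`, not only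
for small `η`. Squaring the Taylor polynomial would leave terms of order four to six; instead the
difference is written as `2 v₀ (x - v₀ - v₁ - v₂ / 2) + (x - v₀ - v₁) (x - v₀ + v₁)`. -/
theorem abs_sq_sub_expansion_le {x v₀ v₁ v₂ b η : ℝ} (h0 : |v₀| ≤ b) (h1 : |v₁| ≤ b * η)
    (r1 : |x - v₀| ≤ b * η) (r2 : |x - v₀ - v₁| ≤ b * η ^ 2)
    (r3 : |x - v₀ - v₁ - v₂ / 2| ≤ b * η ^ 3) :
    |x ^ 2 - (v₀ ^ 2 + 2 * v₀ * v₁ + v₁ ^ 2 + v₀ * v₂)| ≤ 4 * b ^ 2 * η ^ 3 := by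
  have e1 := abs_mul_le_of_le h0 r3
  have e2 := abs_mul_le_of_le r2 ((abs_add_le (x - v₀) v₁).trans (add_le_add r1 h1))
  rw [abs_le] at e1 e2 ⊢
  constructor <;> linarith

section Expansion

variable {k β ρ ΔT : ℝ} {M : ℕ} {i : Fin 3} {r₀ δ : Space}

theorem arrayMean_inner (hx : r₀ 0 = 0) (n : ℕ) :
    arrayMean M (fun m => ‖r₀ - elementPos ΔT m‖⁻¹ ^ (n + 1) *
      inner ℝ (r₀ - elementPos ΔT m) δ) =
      r₀ 2 * δ 2 * arraySum M ΔT r₀ (n + 1) - δ 1 * arraySumBar M ΔT r₀ n := by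
  simp only [arraySum_eq_arrayMean, arraySumBar_eq_arrayMean, ← arrayMean_const_mul,
    ← arrayMean_sub]
  refine arrayMean_congr fun m _ => ?_
  rw [inner_sub_elementPos hx]
  ring

theorem arrayMean_inner_sq (hx : r₀ 0 = 0) (hz : r₀ 2 ≠ 0) (n : ℕ) :
    arrayMean M (fun m => ‖r₀ - elementPos ΔT m‖⁻¹ ^ (n + 2) *
      inner ℝ (r₀ - elementPos ΔT m) δ ^ 2) =
      (r₀ 2 * δ 2) ^ 2 * arraySum M ΔT r₀ (n + 2)
        - 2 * r₀ 2 * δ 1 * δ 2 * arraySumBar M ΔT r₀ (n + 1)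
        + δ 1 ^ 2 * (arraySum M ΔT r₀ n - r₀ 2 ^ 2 * arraySum M ΔT r₀ (n + 2)) := by
  simp only [arraySum_eq_arrayMean, arraySumBar_eq_arrayMean, ← arrayMean_const_mul,
    ← arrayMean_sub, ← arrayMean_add]
  refine arrayMean_congr fun m _ => ?_
  rw [inner_sub_elementPos hx, ← sq_mul_inv_norm_sq hx hz]
  ring

/-- Expansion of the square of one mean field component. The means turn into the sums
`s_M^{(k)}` and `s̄_M^{(k)}`; the second-order coefficient `v₂` matters only for the component with
`v₀ ≠ 0`. -/
theorem exists_meanField_expansion (hk : 0 ≤ k) (hρ : 0 < ρ) (hx : r₀ 0 = 0) (hz : r₀ 2 ≠ 0)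
    (hD : ∀ m ∈ Finset.Icc (-(M : ℤ)) (M : ℤ), ∀ τ ∈ Set.Icc (0 : ℝ) 1,
      ρ ≤ rayDist (r₀ - elementPos ΔT m) δ τ) :
    ∃ v₀ v₁ v₂ : ℝ, |meanField k M ΔT r₀ β i δ 1 ^ 2 - (v₀ ^ 2 + 2 * v₀ * v₁ + v₁ ^ 2 + v₀ * v₂)| ≤
        4 * (arraySum M ΔT r₀ 2 * (fieldBound k).eval (1 / ρ) ^ 2) * ‖δ‖ ^ 3 ∧
      v₀ = Real.cos β * (if i = 0 then 1 else 0) * arraySum M ΔT r₀ 2 ∧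
      v₁ = (-(Real.cos β * (r₀ 2 * δ 2 * arraySum M ΔT r₀ 4 - δ 1 * arraySumBar M ΔT r₀ 3))
        - k * Real.sin β * (r₀ 2 * δ 2 * arraySum M ΔT r₀ 3 - δ 1 * arraySumBar M ΔT r₀ 2)) *
          (if i = 0 then 1 else 0)
        - Real.cos β * δ 0 *
          ![0, -arraySumBar M ΔT r₀ 3, r₀ 2 * arraySum M ΔT r₀ 4] i ∧
      (i = 0 → β = 0 → v₂ =
        3 * ((r₀ 2 * δ 2) ^ 2 * arraySum M ΔT r₀ 6
          - 2 * r₀ 2 * δ 1 * δ 2 * arraySumBar M ΔT r₀ 5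
          + δ 1 ^ 2 * (arraySum M ΔT r₀ 4 - r₀ 2 ^ 2 * arraySum M ΔT r₀ 6))
        - (‖δ‖ ^ 2 + 2 * δ 0 ^ 2) * arraySum M ΔT r₀ 4
        - k ^ 2 * ((r₀ 2 * δ 2) ^ 2 * arraySum M ΔT r₀ 4
          - 2 * r₀ 2 * δ 1 * δ 2 * arraySumBar M ΔT r₀ 3
          + δ 1 ^ 2 * (arraySum M ΔT r₀ 2 - r₀ 2 ^ 2 * arraySum M ΔT r₀ 4))) := by
  have hjet : ∀ m ∈ Finset.Icc (-(M : ℤ)) (M : ℤ), _ := fun m hm =>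
    exists_isJet_rayField (β := β) (i := i) hk hρ (hD m hm) ((sub_elementPos_zero r₀).trans hx)
  choose! f₁ f₂ f₃ hJ hf₀ hf₁ hf₂ using hjet
  set K := (fieldBound k).eval (1 / ρ)
  -- A bound for every element passes to the weighted mean.
  have mean_le {g : ℤ → ℝ} {B : ℝ} (h : ∀ m ∈ Finset.Icc (-(M : ℤ)) (M : ℤ), |g m| ≤ B) :
      |arrayMean M fun m => ‖r₀ - elementPos ΔT m‖⁻¹ * g m| ≤ B * arraySum M ΔT r₀ 1 := by
    rw [arraySum_eq_arrayMean, ← arrayMean_const_mul]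
    refine abs_arrayMean_le fun m hm => ?_
    rw [pow_one, abs_mul, abs_inv, abs_norm, mul_comm]
    exact mul_le_mul_of_nonneg_right (h m hm) (by positivity)
  have h01 : (0 : ℝ) ∈ Set.Icc (0 : ℝ) 1 := by simp
  have key := abs_sq_sub_expansion_le (x := meanField k M ΔT r₀ β i δ 1)
    (v₀ := meanField k M ΔT r₀ β i δ 0)
    (v₁ := arrayMean M fun m => ‖r₀ - elementPos ΔT m‖⁻¹ * f₁ m 0)
    (v₂ := arrayMean M fun m => ‖r₀ - elementPos ΔT m‖⁻¹ * f₂ m 0)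
    (b := K * arraySum M ΔT r₀ 1) (η := ‖δ‖)
    (mean_le fun m hm => (hJ m hm).bound₀ 0 h01)
    (by rw [mul_right_comm]; exact mean_le fun m hm => (hJ m hm).bound₁ 0 h01)
    (by
      rw [mul_right_comm, meanField, meanField, ← arrayMean_sub]
      simp only [← mul_sub]
      exact mean_le fun m hm => (hJ m hm).taylor_one)
    (by
      rw [mul_right_comm, meanField, meanField, ← arrayMean_sub, ← arrayMean_sub]
      simp only [← mul_sub]
      exact mean_le fun m hm => (hJ m hm).taylor_two)
    (by
      rw [mul_right_comm, meanField, meanField, div_eq_inv_mul, ← arrayMean_sub, ← arrayMean_sub,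
        ← arrayMean_const_mul, ← arrayMean_sub]
      simp only [mul_left_comm (2 : ℝ)⁻¹, ← mul_sub, ← div_eq_inv_mul (b := (2 : ℝ))]
      exact mean_le fun m hm => (hJ m hm).taylor_three)
  refine ⟨_, _, _, key.trans ?_, ?_, ?_, ?_⟩
  · have h := mul_le_mul_of_nonneg_left (arraySum_one_sq_le (M := M) (ΔT := ΔT) (r₀ := r₀))
      (sq_nonneg K)
    refine mul_le_mul_of_nonneg_right ?_ (by positivity)
    linarith
  · rw [arraySum_eq_arrayMean, ← arrayMean_const_mul]
    refine arrayMean_congr fun m hm => ?_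
    rw [hf₀ m hm]
    ring
  · have e3 := arrayMean_inner (M := M) (ΔT := ΔT) (δ := δ) hx 3
    have e2 := arrayMean_inner (M := M) (ΔT := ΔT) (δ := δ) hx 2
    have ei : arrayMean M (fun m => ‖r₀ - elementPos ΔT m‖⁻¹ ^ 4 * (r₀ - elementPos ΔT m) i) =
        ![0, -arraySumBar M ΔT r₀ 3, r₀ 2 * arraySum M ΔT r₀ 4] i := by
      fin_cases i
      · simp [sub_elementPos_zero, hx, arrayMean_zero, -PiLp.sub_apply]
      · simp only [Fin.mk_one, sub_elementPos_one, Matrix.cons_val, arraySumBar_eq_arrayMean,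
          ← arrayMean_neg]
        refine arrayMean_congr fun m _ => ?_
        ring
      · simp only [Fin.reduceFinMk, sub_elementPos_two, Matrix.cons_val, arraySum_eq_arrayMean,
          ← arrayMean_const_mul]
        refine arrayMean_congr fun m _ => ?_
        ring
    rw [← e3, ← e2, ← ei, mul_comm _ (if i = 0 then (1 : ℝ) else 0)]
    simp only [← arrayMean_const_mul, ← arrayMean_neg, ← arrayMean_sub]
    refine arrayMean_congr fun m hm => ?_
    rw [hf₁ m hm]
    ring
  · intro hi hβ
    have e4 := arrayMean_inner_sq (M := M) (ΔT := ΔT) (δ := δ) hx hz 4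
    have e2 := arrayMean_inner_sq (M := M) (ΔT := ΔT) (δ := δ) hx hz 2
    rw [← e4, ← e2]
    simp only [arraySum_eq_arrayMean, ← arrayMean_const_mul, ← arrayMean_sub]
    refine arrayMean_congr fun m hm => ?_
    rw [hf₂ m hm hi hβ]
    ring

/-- The total received power, up to a constant factor: the sum of the squares of the three mean
field components in phase (`β = 0`) and in quadrature (`β = -π / 2`). -/
noncomputable def meanPower (k : ℝ) (M : ℕ) (ΔT : ℝ) (r₀ δ : Space) (τ : ℝ) : ℝ :=
  ∑ i, (meanField k M ΔT r₀ 0 i δ τ ^ 2 + meanField k M ΔT r₀ (-(Real.pi / 2)) i δ τ ^ 2)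

/-- The six expansions add up to the quadratic form of `mVec` and `matM`. Only the in-phase first
component has a non-zero constant term, and the quadrature of the other two vanishes to first
order. -/
theorem abs_meanPower_sub_le {lam : ℝ} (hlam : 0 < lam) (hρ : 0 < ρ) (hx : r₀ 0 = 0)
    (hz : r₀ 2 ≠ 0)
    (hD : ∀ m ∈ Finset.Icc (-(M : ℤ)) (M : ℤ), ∀ τ ∈ Set.Icc (0 : ℝ) 1,
      ρ ≤ rayDist (r₀ - elementPos ΔT m) δ τ) :
    |meanPower (2 * Real.pi / lam) M ΔT r₀ δ 1 - arraySum M ΔT r₀ 2 ^ 2 *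
        (1 - (2 * (δ.ofLp ⬝ᵥ mVec M ΔT r₀) + δ.ofLp ⬝ᵥ (matM lam M ΔT r₀ *ᵥ δ.ofLp)))| ≤
      24 * (arraySum M ΔT r₀ 2 * (fieldBound (2 * Real.pi / lam)).eval (1 / ρ) ^ 2) *
        ‖δ‖ ^ 3 := by
  have hk : 0 ≤ 2 * Real.pi / lam := by positivity
  have hs := (arraySum_pos (M := M) (ΔT := ΔT) hz 2).ne'
  have hδ : ‖δ‖ ^ 2 = δ 0 ^ 2 + δ 1 ^ 2 + δ 2 ^ 2 := by
    rw [EuclideanSpace.real_norm_sq_eq, Fin.sum_univ_three]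
  obtain ⟨a₀, a₁, a₂, ha, ha₀, ha₁, ha₂⟩ :=
    exists_meanField_expansion (β := 0) (i := 0) hk hρ hx hz hD
  obtain ⟨b₀, b₁, b₂, hb, hb₀, hb₁, -⟩ :=
    exists_meanField_expansion (β := -(Real.pi / 2)) (i := 0) hk hρ hx hz hD
  obtain ⟨c₀, c₁, c₂, hc, hc₀, hc₁, -⟩ :=
    exists_meanField_expansion (β := 0) (i := 1) hk hρ hx hz hD
  obtain ⟨d₀, d₁, d₂, hd, hd₀, hd₁, -⟩ :=
    exists_meanField_expansion (β := -(Real.pi / 2)) (i := 1) hk hρ hx hz hD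
  obtain ⟨e₀, e₁, e₂, he, he₀, he₁, -⟩ :=
    exists_meanField_expansion (β := 0) (i := 2) hk hρ hx hz hD
  obtain ⟨g₀, g₁, g₂, hg, hg₀, hg₁, -⟩ :=
    exists_meanField_expansion (β := -(Real.pi / 2)) (i := 2) hk hρ hx hz hD
  have ha₂ := ha₂ rfl rfl
  simp only [Real.cos_zero, Real.sin_zero, Real.cos_neg, Real.sin_neg, Real.cos_pi_div_two,
    Real.sin_pi_div_two, if_true, one_ne_zero, if_false, Fin.reduceEq, Matrix.cons_val]
    at ha₀ ha₁ hb₀ hb₁ hc₀ hc₁ hd₀ hd₁ he₀ he₁ hg₀ hg₁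
  have main : arraySum M ΔT r₀ 2 ^ 2 *
      (1 - (2 * (δ.ofLp ⬝ᵥ mVec M ΔT r₀) + δ.ofLp ⬝ᵥ (matM lam M ΔT r₀ *ᵥ δ.ofLp))) =
      (a₀ ^ 2 + 2 * a₀ * a₁ + a₁ ^ 2 + a₀ * a₂) + (b₀ ^ 2 + 2 * b₀ * b₁ + b₁ ^ 2 + b₀ * b₂)
      + (c₀ ^ 2 + 2 * c₀ * c₁ + c₁ ^ 2 + c₀ * c₂) + (d₀ ^ 2 + 2 * d₀ * d₁ + d₁ ^ 2 + d₀ * d₂)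
      + (e₀ ^ 2 + 2 * e₀ * e₁ + e₁ ^ 2 + e₀ * e₂)
      + (g₀ ^ 2 + 2 * g₀ * g₁ + g₁ ^ 2 + g₀ * g₂) := by
    rw [ha₀, ha₁, ha₂, hb₀, hb₁, hc₀, hc₁, hd₀, hd₁, he₀, he₁, hg₀, hg₁, hδ]
    simp only [dotProduct, Matrix.mulVec, Fin.sum_univ_three, mVec, mVec2, matM, matM2, matA, matB,
      gammaOne, Matrix.add_apply, Matrix.smul_apply, Pi.smul_apply, smul_eq_mul, Matrix.cons_val,
      Matrix.of_apply, Matrix.cons_val']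
    generalize 2 * Real.pi / lam = k
    field_simp
    ring
  rw [main, meanPower, Fin.sum_univ_three]
  rw [abs_le] at ha hb hc hd he hg ⊢
  constructor <;> linarith

end Expansion

/-! ### The dominant singular vector -/

section Channel

variable {M t : ℕ} {ht : t ≤ 3} {ξ : ℂ} {lam ΔT : ℝ} {m : ℤ} {r r₀ : Space}

theorem projPerp_apply (i j : Fin 3) : projPerp ΔT m r i j = (if i = j then 1 else 0) -
    ((r - elementPos ΔT m) i * ‖r - elementPos ΔT m‖⁻¹) *
      ((r - elementPos ΔT m) j * ‖r - elementPos ΔT m‖⁻¹) := by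
  simp only [projPerp, proj, Matrix.sub_apply, Matrix.one_apply, Matrix.smul_apply, smul_eq_mul,
    Matrix.vecMulVec_apply, one_div]
  ring

theorem projPerp_zero_apply (hx : r 0 = 0) (j : Fin 3) :
    (projPerp ΔT m r 0 j : ℂ) = if j = 0 then 1 else 0 := by
  rw [projPerp_apply, sub_elementPos_zero, hx]
  simp [eq_comm, apply_ite]

theorem projPerp_apply_zero (hx : r 0 = 0) (i : Fin 3) :
    (projPerp ΔT m r i 0 : ℂ) = if i = 0 then 1 else 0 := by
  rw [projPerp_apply, sub_elementPos_zero, hx]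
  simp [apply_ite]

theorem sum_castLE_le (ht : t ≤ 3) {f : Fin 3 → ℝ} (hf : ∀ j, 0 ≤ f j) :
    ∑ j, f (Fin.castLE ht j) ≤ ∑ j, f j := by
  calc _ = ∑ j ∈ Finset.univ.map (Fin.castLEEmb ht), f j := by simp
    _ ≤ _ := Finset.sum_le_sum_of_subset_of_nonneg (Finset.subset_univ _) fun j _ _ => hf j

theorem channel_apply (i : Fin 3) (c : ArrayIdx M × Fin t) :
    channel M t ht ξ lam ΔT r i c =
      scalarChannel ξ lam ΔT c.1 r * (projPerp ΔT c.1 r i (Fin.castLE ht c.2) : ℂ) := rfl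

/-- The columns are indexed by the elements and the transmit polarizations, so that a sum over
them in which only the first polarization contributes is a sum over the elements. -/
theorem sum_castLE_eq_zero (h1 : 1 ≤ t) (f : ℤ → Fin 3 → ℂ) :
    ∑ c : ArrayIdx M × Fin t,
      f c.1 (Fin.castLE ht c.2) * (if Fin.castLE ht c.2 = 0 then 1 else 0) =
      ∑ m ∈ Finset.Icc (-(M : ℤ)) (M : ℤ), f m 0 := by
  rw [Fintype.sum_prod_type, ← Finset.sum_coe_sort (Finset.Icc (-(M : ℤ)) (M : ℤ))]
  refine Finset.sum_congr rfl fun m _ => ?_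
  dsimp only
  have h0 : Fin.castLE ht ⟨0, h1⟩ = 0 := rfl
  rw [Finset.sum_eq_single (⟨0, h1⟩ : Fin t)]
  · simp [h0]
  · intro j _ hj
    have : Fin.castLE ht j ≠ 0 := fun h => hj (Fin.ext (by simpa using congrArg Fin.val h))
    simp [this]
  · simp

theorem normSq_scalarChannel : Complex.normSq (scalarChannel ξ lam ΔT m r) =
    (‖ξ‖ / lam) ^ 2 * ‖r - elementPos ΔT m‖⁻¹ ^ 2 := by
  have h : -(Complex.I * (((2 * Real.pi / lam) * ‖r - elementPos ΔT m‖ : ℝ) : ℂ)) =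
      ((-((2 * Real.pi / lam) * ‖r - elementPos ΔT m‖) : ℝ) : ℂ) * Complex.I := by
    push_cast
    ring
  rw [scalarChannel, h, Complex.normSq_eq_norm_sq, norm_mul, Complex.norm_exp_ofReal_mul_I, norm_mul,
    norm_div, norm_div, Complex.norm_real, Complex.norm_real, norm_one, norm_norm, mul_one, mul_pow,
    div_pow, Real.norm_eq_abs, sq_abs, one_div, div_pow]

theorem normSq_scalarChannel_pos (hξ : ξ ≠ 0) (hlam : 0 < lam) (hz : r 2 ≠ 0) :
    0 < Complex.normSq (scalarChannel ξ lam ΔT m r) := by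
  rw [normSq_scalarChannel]
  have := norm_sub_elementPos_pos (ΔT := ΔT) (m := m) hz
  have := norm_pos_iff.2 hξ
  positivity

/-- The projection removes exactly the energy along the direction of the element. -/
theorem sum_normSq_projPerp (hx : r 0 = 0) (hz : r 2 ≠ 0) (u : Fin 3 → ℂ) :
    ∑ j, Complex.normSq (∑ i, (projPerp ΔT m r i j : ℂ) * u i) = ∑ j, Complex.normSq (u j) -
      ‖r - elementPos ΔT m‖⁻¹ ^ 2 * Complex.normSq
        ((r 2 : ℂ) * u 2 - ((m : ℂ) * ΔT - r 1) * u 1) := by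
  have hp := (norm_sub_elementPos_pos (ΔT := ΔT) (m := m) hz).ne'
  have hd := norm_sub_elementPos_sq (ΔT := ΔT) (m := m) hx
  have h : ‖r - elementPos ΔT m‖⁻¹ ^ 2 * (((m : ℝ) * ΔT - r 1) ^ 2 + r 2 ^ 2) = 1 := by
    rw [← hd]
    field_simp
  simp only [Fin.sum_univ_three, projPerp_apply, sub_elementPos_zero, sub_elementPos_one,
    sub_elementPos_two, hx, Fin.reduceEq, if_true, if_false, one_ne_zero, zero_ne_one]
  generalize ‖r - elementPos ΔT m‖⁻¹ = p at *
  simp only [Complex.normSq_apply, Complex.add_re, Complex.add_im, Complex.sub_re, Complex.sub_im,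
    Complex.mul_re, Complex.mul_im, Complex.ofReal_re, Complex.ofReal_im, Complex.intCast_re,
    Complex.intCast_im]
  linear_combination (p ^ 2 * (((r 2 * (u 2).re - ((m : ℝ) * ΔT - r 1) * (u 1).re)) ^ 2 +
    ((r 2 * (u 2).im - ((m : ℝ) * ΔT - r 1) * (u 1).im)) ^ 2)) * h

/-- The channel matrix divided by the square root of the number of elements. -/
noncomputable def normChannel (M t : ℕ) (ht : t ≤ 3) (ξ : ℂ) (lam ΔT : ℝ) (r : Space) :
    Matrix (Fin 3) (ArrayIdx M × Fin t) ℂ :=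
  ((1 / Real.sqrt (2 * (M : ℝ) + 1) : ℝ) : ℂ) • channel M t ht ξ lam ΔT r

/-- The mean of `|h_m|²` over the array. At a point of the `yz`-plane it is the square of the
maximum singular value of `normChannel`. -/
noncomputable def meanGain (M : ℕ) (ξ : ℂ) (lam ΔT : ℝ) (r : Space) : ℝ :=
  arrayMean M fun m => Complex.normSq (scalarChannel ξ lam ΔT m r)

theorem sqrt_array_inv_sq :
    (1 / Real.sqrt (2 * (M : ℝ) + 1)) ^ 2 = 1 / (2 * (M : ℝ) + 1) := by
  rw [div_pow, one_pow, Real.sq_sqrt (by positivity)]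

theorem normChannel_conjTranspose_mulVec (u : Fin 3 → ℂ) (c : ArrayIdx M × Fin t) :
    ((normChannel M t ht ξ lam ΔT r)ᴴ *ᵥ u) c =
      ((1 / Real.sqrt (2 * (M : ℝ) + 1) : ℝ) : ℂ) * star (scalarChannel ξ lam ΔT c.1 r) *
        ∑ i, (projPerp ΔT c.1 r i (Fin.castLE ht c.2) : ℂ) * u i := by
  rw [Matrix.mulVec, dotProduct, Finset.mul_sum]
  refine Finset.sum_congr rfl fun i _ => ?_
  simp only [normChannel, Matrix.conjTranspose_apply, Matrix.smul_apply, smul_eq_mul, channel_apply,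
    star_mul', Complex.star_def, Complex.conj_ofReal]
  ring

theorem star_dotProduct_self {n : Type*} [Fintype n] (v : n → ℂ) :
    star v ⬝ᵥ v = ((∑ i, Complex.normSq (v i) : ℝ) : ℂ) := by
  rw [dotProduct, Complex.ofReal_sum]
  refine Finset.sum_congr rfl fun i _ => ?_
  rw [Pi.star_apply, Complex.star_def, Complex.normSq_eq_conj_mul_self]

/-- The first coordinate vector is a left singular vector, with squared singular value
`meanGain`. -/
theorem exists_isSingularTriple (h1 : 1 ≤ t) (hx : r 0 = 0)
    (hS : 0 < meanGain M ξ lam ΔT r) :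
    ∃ v, IsSingularTriple (normChannel M t ht ξ lam ΔT r) (Real.sqrt (meanGain M ξ lam ΔT r))
      (Pi.single 0 1) v := by
  set A := normChannel M t ht ξ lam ΔT r with hA
  set S := meanGain M ξ lam ΔT r with hSdef
  set e : Fin 3 → ℂ := Pi.single 0 1
  have hs : (Real.sqrt S : ℂ) ≠ 0 := by
    exact_mod_cast (Real.sqrt_pos.2 hS).ne'
  have hss : (Real.sqrt S : ℂ) * Real.sqrt S = S := by
    exact_mod_cast Real.mul_self_sqrt hS.le
  have hAe : ∀ c, (Aᴴ *ᵥ e) c = ((1 / Real.sqrt (2 * (M : ℝ) + 1) : ℝ) : ℂ) *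
      star (scalarChannel ξ lam ΔT c.1 r) * (if Fin.castLE ht c.2 = 0 then 1 else 0) := fun c => by
    rw [normChannel_conjTranspose_mulVec]
    simp [e, Fin.sum_univ_three, projPerp_zero_apply hx]
  have hAA : A *ᵥ (Aᴴ *ᵥ e) = (S : ℂ) • e := by
    funext i
    have h := sum_castLE_eq_zero (M := M) (ht := ht) h1
      (fun m j => ((1 / Real.sqrt (2 * (M : ℝ) + 1) : ℝ) : ℂ) ^ 2 *
        Complex.normSq (scalarChannel ξ lam ΔT m r) * (projPerp ΔT m r i j : ℂ))
    rw [Matrix.mulVec, dotProduct]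
    calc _ = _ := ?_
      _ = _ := h
      _ = _ := ?_
    · refine Finset.sum_congr rfl fun c _ => ?_
      rw [hAe, hA, normChannel, Matrix.smul_apply, smul_eq_mul, channel_apply,
        Complex.normSq_eq_conj_mul_self, Complex.star_def]
      ring
    · simp only [projPerp_apply_zero hx]
      rw [← Finset.sum_mul, ← Finset.mul_sum, ← Complex.ofReal_pow, sqrt_array_inv_sq, hSdef,
        meanGain, arrayMean]
      push_cast
      simp [e, Pi.single_apply]
  refine ⟨(Real.sqrt S : ℂ)⁻¹ • (Aᴴ *ᵥ e), Real.sqrt_nonneg _, ?_, ?_, ?_, ?_⟩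
  · simp [e]
  · have hee : star e ⬝ᵥ e = 1 := by simp [e]
    rw [star_smul, smul_dotProduct, dotProduct_smul, Matrix.star_mulVec,
      Matrix.conjTranspose_conjTranspose, ← Matrix.dotProduct_mulVec, hAA, dotProduct_smul, hee,
      Complex.star_def, map_inv₀, Complex.conj_ofReal]
    simp only [smul_eq_mul, mul_one, ← hss]
    field_simp
  · rw [Matrix.mulVec_smul, hAA, smul_smul, ← hss]
    congr 1
    field_simp
  · rw [smul_smul, mul_inv_cancel₀ hs, one_smul]

theorem meanGain_eq : meanGain M ξ lam ΔT r = (‖ξ‖ / lam) ^ 2 * arraySum M ΔT r 2 := by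
  simp only [meanGain, normSq_scalarChannel, arrayMean_const_mul, arraySum_eq_arrayMean]

/-- A left singular vector `u` of the maximum singular value `s` has no component in the
`yz`-plane. By maximality `s² = ‖Aᴴ u‖²` is at least `meanGain`, but each element loses the energy
of `u` along its own direction, so that `u` is orthogonal to all these directions; they span the
plane as soon as there are two elements. -/
theorem IsMaxSingularPair.left_eq_zero (h1 : 1 ≤ t) (hM : 1 ≤ M) (hξ : ξ ≠ 0) (hlam : 0 < lam)
    (hΔT : 0 < ΔT) (hx : r 0 = 0) (hz : r 2 ≠ 0) {u : Fin 3 → ℂ} {w : ArrayIdx M × Fin t → ℂ}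
    (h : IsMaxSingularPair (normChannel M t ht ξ lam ΔT r) u w) : u 1 = 0 ∧ u 2 = 0 := by
  obtain ⟨s, ⟨hs0, hu, hw, -, hAu⟩, hmax⟩ := h
  have hS : 0 < meanGain M ξ lam ΔT r := by
    rw [meanGain_eq]
    have := arraySum_pos (M := M) (ΔT := ΔT) hz 2
    have := norm_pos_iff.2 hξ
    positivity
  obtain ⟨v, hv⟩ := exists_isSingularTriple (ht := ht) h1 hx hS
  have hsS : meanGain M ξ lam ΔT r ≤ s ^ 2 := (Real.sqrt_le_left hs0).1 (hmax _ _ _ hv)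
  have hu' : ∑ j, Complex.normSq (u j) = 1 := by
    rw [star_dotProduct_self] at hu
    exact_mod_cast hu
  have hw' : ∑ c, Complex.normSq (w c) = 1 := by
    rw [star_dotProduct_self] at hw
    exact_mod_cast hw
  -- The energy of `Aᴴ u = s w`, element by element.
  have hsum : s ^ 2 = ∑ c : ArrayIdx M × Fin t, 1 / (2 * (M : ℝ) + 1) *
      Complex.normSq (scalarChannel ξ lam ΔT c.1 r) *
      Complex.normSq (∑ i, (projPerp ΔT c.1 r i (Fin.castLE ht c.2) : ℂ) * u i) := by
    calc s ^ 2 = ∑ c, Complex.normSq (((s : ℂ) • w) c) := by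
          simp only [Pi.smul_apply, smul_eq_mul, map_mul, Complex.normSq_ofReal, ← Finset.mul_sum,
            hw']
          ring
      _ = _ := by
          rw [← hAu]
          refine Finset.sum_congr rfl fun c _ => ?_
          rw [normChannel_conjTranspose_mulVec, map_mul, map_mul, Complex.normSq_ofReal,
            Complex.star_def, Complex.normSq_conj, ← pow_two, sqrt_array_inv_sq]
  have hle : s ^ 2 ≤ arrayMean M fun m => Complex.normSq (scalarChannel ξ lam ΔT m r) *
      (1 - ‖r - elementPos ΔT m‖⁻¹ ^ 2 * Complex.normSq
        ((r 2 : ℂ) * u 2 - ((m : ℂ) * ΔT - r 1) * u 1)) := by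
    rw [hsum, arrayMean, Finset.mul_sum, Fintype.sum_prod_type,
      ← Finset.sum_coe_sort (Finset.Icc (-(M : ℤ)) (M : ℤ))]
    refine Finset.sum_le_sum fun m _ => ?_
    dsimp only
    rw [← Finset.mul_sum, mul_assoc]
    refine mul_le_mul_of_nonneg_left (mul_le_mul_of_nonneg_left ?_ (Complex.normSq_nonneg _))
      (by positivity)
    rw [← hu', ← sum_normSq_projPerp hx hz]
    exact sum_castLE_le ht
      (f := fun j => Complex.normSq (∑ i, (projPerp ΔT m r i j : ℂ) * u i))
      fun j => Complex.normSq_nonneg _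
  have hzero : ∑ m ∈ Finset.Icc (-(M : ℤ)) (M : ℤ), Complex.normSq (scalarChannel ξ lam ΔT m r) *
      (‖r - elementPos ΔT m‖⁻¹ ^ 2 * Complex.normSq
        ((r 2 : ℂ) * u 2 - ((m : ℂ) * ΔT - r 1) * u 1)) ≤ 0 := by
    have hN : 0 < 1 / (2 * (M : ℝ) + 1) := by positivity
    simp only [mul_sub, mul_one] at hle
    rw [arrayMean_sub] at hle
    have h0 := (hsS.trans hle)
    rw [meanGain] at h0
    exact nonpos_of_mul_nonpos_right (b := ∑ m ∈ Finset.Icc (-(M : ℤ)) (M : ℤ), _)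
      (by simpa [arrayMean] using h0) hN
  have hterm : ∀ m ∈ Finset.Icc (-(M : ℤ)) (M : ℤ),
      (r 2 : ℂ) * u 2 - ((m : ℂ) * ΔT - r 1) * u 1 = 0 := by
    intro m hm
    have hnn : ∀ m ∈ Finset.Icc (-(M : ℤ)) (M : ℤ),
        0 ≤ Complex.normSq (scalarChannel ξ lam ΔT m r) * (‖r - elementPos ΔT m‖⁻¹ ^ 2 *
          Complex.normSq ((r 2 : ℂ) * u 2 - ((m : ℂ) * ΔT - r 1) * u 1)) := fun m _ =>
      mul_nonneg (Complex.normSq_nonneg _) (mul_nonneg (by positivity) (Complex.normSq_nonneg _))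
    have h0 := (Finset.sum_eq_zero_iff_of_nonneg hnn).1
      (le_antisymm hzero (Finset.sum_nonneg hnn)) m hm
    have hd := norm_sub_elementPos_pos (ΔT := ΔT) (m := m) hz
    have hh := normSq_scalarChannel_pos (ΔT := ΔT) (m := m) hξ hlam hz
    have hd' : ‖r - elementPos ΔT m‖⁻¹ ^ 2 ≠ 0 := by positivity
    simpa [hh.ne', hd', -mul_eq_zero, mul_eq_zero, hd.ne'] using h0
  have e0 := hterm 0 (by simp)
  have e1 := hterm 1 (by simp; omega)
  have hΔ : (ΔT : ℂ) ≠ 0 := by exact_mod_cast hΔT.ne'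
  have hz' : (r 2 : ℂ) ≠ 0 := by exact_mod_cast hz
  push_cast at e0 e1
  have hu1 : u 1 = 0 := by
    have : (ΔT : ℂ) * u 1 = 0 := by linear_combination e0 - e1
    exact (mul_eq_zero.1 this).resolve_left hΔ
  refine ⟨hu1, ?_⟩
  rw [hu1] at e0
  simpa [hz'] using e0

/-- The dominant right singular vector is the matched filter for the first polarization. -/
theorem IsMaxSingularPair.right_eq (h1 : 1 ≤ t) (hM : 1 ≤ M) (hξ : ξ ≠ 0) (hlam : 0 < lam)
    (hΔT : 0 < ΔT) (hx : r 0 = 0) (hz : r 2 ≠ 0) {u : Fin 3 → ℂ} {w : ArrayIdx M × Fin t → ℂ}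
    (h : IsMaxSingularPair (normChannel M t ht ξ lam ΔT r) u w) :
    ∃ a : ℂ, Complex.normSq a * ((2 * (M : ℝ) + 1) * meanGain M ξ lam ΔT r) = 1 ∧
      ∀ c, w c = a * star (scalarChannel ξ lam ΔT c.1 r) *
        (if Fin.castLE ht c.2 = 0 then 1 else 0) := by
  obtain ⟨hu1, hu2⟩ := h.left_eq_zero h1 hM hξ hlam hΔT hx hz
  obtain ⟨s, ⟨hs0, hu, hw, -, hAu⟩, hmax⟩ := h
  have hS : 0 < meanGain M ξ lam ΔT r := by
    rw [meanGain_eq]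
    have := arraySum_pos (M := M) (ΔT := ΔT) hz 2
    have := norm_pos_iff.2 hξ
    positivity
  obtain ⟨v, hv⟩ := exists_isSingularTriple (ht := ht) h1 hx hS
  have hs : (s : ℂ) ≠ 0 := by
    exact_mod_cast ((Real.sqrt_pos.2 hS).trans_le (hmax _ _ _ hv)).ne'
  have hwc : ∀ c, w c = ((s : ℂ)⁻¹ * ((1 / Real.sqrt (2 * (M : ℝ) + 1) : ℝ) : ℂ) * u 0) *
      star (scalarChannel ξ lam ΔT c.1 r) * (if Fin.castLE ht c.2 = 0 then 1 else 0) := by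
    intro c
    have hc := congrFun hAu c
    rw [normChannel_conjTranspose_mulVec, Fin.sum_univ_three, hu1, hu2, projPerp_zero_apply hx,
      Pi.smul_apply, smul_eq_mul] at hc
    rw [← mul_right_inj' hs, ← hc]
    push_cast
    field_simp
    ring
  refine ⟨_, ?_, hwc⟩
  generalize (s : ℂ)⁻¹ * ((1 / Real.sqrt (2 * (M : ℝ) + 1) : ℝ) : ℂ) * u 0 = a at hwc ⊢
  have hsum := sum_castLE_eq_zero (M := M) (ht := ht) h1
    (fun m _ => (Complex.normSq a : ℂ) * Complex.normSq (scalarChannel ξ lam ΔT m r))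
  have hN : (2 * (M : ℝ) + 1) * meanGain M ξ lam ΔT r = ∑ m ∈ Finset.Icc (-(M : ℤ)) (M : ℤ),
      Complex.normSq (scalarChannel ξ lam ΔT m r) := by
    rw [meanGain, arrayMean]
    have : (2 * (M : ℝ) + 1) ≠ 0 := by positivity
    field_simp
  rw [hN, Finset.mul_sum]
  rw [star_dotProduct_self] at hw
  have : ((∑ m ∈ Finset.Icc (-(M : ℤ)) (M : ℤ), Complex.normSq a *
      Complex.normSq (scalarChannel ξ lam ΔT m r) : ℝ) : ℂ) = 1 := by
    rw [← hw]
    push_cast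
    rw [← hsum]
    refine Finset.sum_congr rfl fun c _ => ?_
    rw [hwc c]
    split_ifs <;> simp
  exact_mod_cast this

/-! ### The signal to noise ratio as a received power -/

theorem rayDist_one : rayDist (r₀ - elementPos ΔT m) (r - r₀) 1 = ‖r - elementPos ΔT m‖ := by
  rw [rayDist, one_smul]
  congr 1
  abel

theorem rayProj_one (i : Fin 3) :
    rayProj i (r₀ - elementPos ΔT m) (r - r₀) 1 = projPerp ΔT m r i 0 := by
  have h : ∀ j, rayDir j (r₀ - elementPos ΔT m) (r - r₀) 1 =
      (r - elementPos ΔT m) j * ‖r - elementPos ΔT m‖⁻¹ := fun j => by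
    rw [rayDir, rayDist_one, div_eq_mul_inv]
    simp
  rw [rayProj, h, h, projPerp_apply]
  ring

theorem scalarChannel_mul_star : scalarChannel ξ lam ΔT m r * star (scalarChannel ξ lam ΔT m r₀) =
    (((‖ξ‖ / lam) ^ 2 * (‖r₀ - elementPos ΔT m‖⁻¹ * ‖r - elementPos ΔT m‖⁻¹) : ℝ) : ℂ) *
      Complex.exp (((-(2 * Real.pi / lam *
        (‖r - elementPos ΔT m‖ - ‖r₀ - elementPos ΔT m‖)) : ℝ) : ℂ) * Complex.I) := by
  have h : (ξ * (starRingEnd ℂ) ξ) = (‖ξ‖ : ℂ) ^ 2 := by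
    rw [Complex.mul_conj, Complex.normSq_eq_norm_sq]
    push_cast
    rfl
  simp only [scalarChannel, Complex.star_def, map_mul, map_div₀, map_one, Complex.conj_ofReal,
    ← Complex.exp_conj, map_neg, Complex.conj_I]
  rw [show ((-(2 * Real.pi / lam * (‖r - elementPos ΔT m‖ - ‖r₀ - elementPos ΔT m‖)) : ℝ) : ℂ) *
      Complex.I = -(Complex.I * (((2 * Real.pi / lam) * ‖r - elementPos ΔT m‖ : ℝ) : ℂ)) +
      -(-Complex.I * (((2 * Real.pi / lam) * ‖r₀ - elementPos ΔT m‖ : ℝ) : ℂ)) by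
    push_cast; ring, Complex.exp_add]
  push_cast
  rw [div_pow, ← h]
  ring

/-- The field received from all elements under matched filtering at `r₀`. -/
theorem sum_scalarChannel_mul (i : Fin 3) :
    ∑ m ∈ Finset.Icc (-(M : ℤ)) (M : ℤ), scalarChannel ξ lam ΔT m r *
      star (scalarChannel ξ lam ΔT m r₀) * (projPerp ΔT m r i 0 : ℂ) =
    (((‖ξ‖ / lam) ^ 2 * (2 * (M : ℝ) + 1) : ℝ) : ℂ) *
      (meanField (2 * Real.pi / lam) M ΔT r₀ 0 i (r - r₀) 1 -
        meanField (2 * Real.pi / lam) M ΔT r₀ (-(Real.pi / 2)) i (r - r₀) 1 * Complex.I) := by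
  have hN : (2 * (M : ℂ) + 1) ≠ 0 := by exact_mod_cast (show 2 * M + 1 ≠ 0 by omega)
  have cancel (g x y : ℂ) : g * (2 * (M : ℂ) + 1) * (1 / (2 * (M : ℂ) + 1) * x -
      1 / (2 * (M : ℂ) + 1) * y * Complex.I) = g * (x - y * Complex.I) := by
    field_simp
  simp only [meanField, arrayMean]
  push_cast
  rw [cancel, Finset.sum_mul, ← Finset.sum_sub_distrib, Finset.mul_sum]
  refine Finset.sum_congr rfl fun m _ => ?_
  rw [scalarChannel_mul_star, Complex.exp_mul_I, ← Complex.ofReal_cos, ← Complex.ofReal_sin,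
    Real.cos_neg, Real.sin_neg]
  simp only [rayField, rayPhase, rayDist_one, rayProj_one, add_zero, ← sub_eq_add_neg,
    Real.cos_sub_pi_div_two]
  push_cast
  ring

theorem snr_eq_sum_normSq (Pbar sigma2 : ℝ) (w : ArrayIdx M × Fin t → ℂ) :
    snr Pbar sigma2 M t ht ξ lam ΔT w r =
      Pbar * (∑ i, Complex.normSq ((channel M t ht ξ lam ΔT r *ᵥ w) i)) /
        (sigma2 * (2 * (M : ℝ) + 1)) := by
  rw [snr, ← Matrix.mulVec_mulVec, Matrix.dotProduct_mulVec, ← Matrix.star_mulVec,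
    star_dotProduct_self, Complex.ofReal_re]

/-- With the dominant singular vector at `r₀` as transmit filter, the signal to noise ratio is the
received power relative to `s_M^{(2)}`; the global phase of the singular vector cancels. -/
theorem snr_eq_meanPower (h1 : 1 ≤ t) (hM : 1 ≤ M) (hξ : ξ ≠ 0) (hlam : 0 < lam) (hΔT : 0 < ΔT)
    (hx : r₀ 0 = 0) (hz : r₀ 2 ≠ 0) {u : Fin 3 → ℂ} {w : ArrayIdx M × Fin t → ℂ}
    (h : IsMaxSingularPair (normChannel M t ht ξ lam ΔT r₀) u w) (Pbar sigma2 : ℝ) (r : Space) :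
    snr Pbar sigma2 M t ht ξ lam ΔT w r = Pbar * (‖ξ‖ / lam) ^ 2 / sigma2 *
      (meanPower (2 * Real.pi / lam) M ΔT r₀ (r - r₀) 1 / arraySum M ΔT r₀ 2) := by
  obtain ⟨a, ha, hw⟩ := h.right_eq h1 hM hξ hlam hΔT hx hz
  have hi : ∀ i, Complex.normSq ((channel M t ht ξ lam ΔT r *ᵥ w) i) =
      Complex.normSq a * ((‖ξ‖ / lam) ^ 2 * (2 * (M : ℝ) + 1)) ^ 2 *
        (meanField (2 * Real.pi / lam) M ΔT r₀ 0 i (r - r₀) 1 ^ 2 +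
          meanField (2 * Real.pi / lam) M ΔT r₀ (-(Real.pi / 2)) i (r - r₀) 1 ^ 2) := by
    intro i
    have hsum : (channel M t ht ξ lam ΔT r *ᵥ w) i =
        a * ((((‖ξ‖ / lam) ^ 2 * (2 * (M : ℝ) + 1) : ℝ) : ℂ) *
      (meanField (2 * Real.pi / lam) M ΔT r₀ 0 i (r - r₀) 1 -
        meanField (2 * Real.pi / lam) M ΔT r₀ (-(Real.pi / 2)) i (r - r₀) 1 * Complex.I)) := by
      rw [← sum_scalarChannel_mul, Finset.mul_sum, ← sum_castLE_eq_zero (ht := ht) h1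
        (fun m j => a * (scalarChannel ξ lam ΔT m r * star (scalarChannel ξ lam ΔT m r₀) *
          (projPerp ΔT m r i j : ℂ)))]
      refine Finset.sum_congr rfl fun c _ => ?_
      dsimp only
      rw [hw, channel_apply]
      ring
    rw [hsum, map_mul, map_mul, Complex.normSq_ofReal]
    simp only [Complex.normSq_apply, Complex.sub_re, Complex.sub_im, Complex.mul_re, Complex.mul_im,
      Complex.ofReal_re, Complex.ofReal_im, Complex.I_re, Complex.I_im]
    ring
  have hs := (arraySum_pos (M := M) (ΔT := ΔT) hz 2).ne'
  have hN : (2 * (M : ℝ) + 1) ≠ 0 := by positivity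
  have hg : (‖ξ‖ / lam) ^ 2 ≠ 0 := by
    have := norm_pos_iff.2 hξ
    positivity
  rw [meanGain_eq] at ha
  rw [snr_eq_sum_normSq]
  simp only [hi, ← Finset.mul_sum]
  rw [← meanPower]
  generalize meanPower (2 * Real.pi / lam) M ΔT r₀ (r - r₀) 1 = W at *
  generalize (‖ξ‖ / lam) ^ 2 = g at *
  have ha' : Complex.normSq a = ((2 * (M : ℝ) + 1) * (g * arraySum M ΔT r₀ 2))⁻¹ :=
    eq_inv_of_mul_eq_one_left ha
  rw [ha']
  field_simp

end Channel

/-! ### The second-order expansion -/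

/-- A lower bound for the distances along the segment, in terms of the ray parameter. -/
theorem le_rayDist_of_segment {r r₀ p : Space} {ρ : ℝ} (h : ∀ q ∈ segment ℝ r₀ r, ρ ≤ ‖q - p‖) :
    ∀ τ ∈ Set.Icc (0 : ℝ) 1, ρ ≤ rayDist (r₀ - p) (r - r₀) τ := by
  intro τ hτ
  refine (h (r₀ + τ • (r - r₀)) ?_).trans_eq ?_
  · rw [segment_eq_image']
    exact ⟨τ, hτ, rfl⟩
  · rw [rayDist]
    congr 1
    abel

theorem snr_of_eq_zero (Pbar sigma2 : ℝ) {M t : ℕ} {ht : t ≤ 3} {lam ΔT : ℝ}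
    (w : ArrayIdx M × Fin t → ℂ) (r : Space) : snr Pbar sigma2 M t ht 0 lam ΔT w r = 0 := by
  have h : channel M t ht 0 lam ΔT r = 0 := by
    ext i c
    simp [channel_apply, scalarChannel]
  simp [snr, h]

end Beamfocusing

open Beamfocusing in
theorem proposition2 :
    -- the scalar `γ_M^{(1)}` is non-negative
    (∀ (M : ℕ) (ΔT : ℝ) (r₀ : Space), 0 < ΔT → r₀ 0 = 0 → r₀ 2 ≠ 0 →
      0 ≤ gammaOne M ΔT r₀) ∧
    -- second-order expansion, with an error term controlled by a polynomial `P` that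
    -- depends only on `|ξ|`, `P̄`, `σ²` and `λ`
    (∀ (absξ Pbar sigma2 lam : ℝ), 0 < Pbar → 0 < sigma2 → 0 < lam →
      ∃ P : Polynomial ℝ,
        ∀ (ξ : ℂ), ‖ξ‖ = absξ →
        ∀ (M : ℕ), 1 ≤ M → ∀ (t : ℕ), 1 ≤ t → ∀ (ht : t ≤ 3),
        ∀ (ΔT : ℝ), 0 < ΔT →
        ∀ (r₀ : Space), r₀ 0 = 0 → r₀ 2 ≠ 0 →
        ∀ (u : Fin 3 → ℂ) (w : ArrayIdx M × Fin t → ℂ),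
          IsMaxSingularPair
            (((1 / Real.sqrt (2 * (M : ℝ) + 1) : ℝ) : ℂ) • channel M t ht ξ lam ΔT r₀) u w →
        ∀ (r : Space) (ρ : ℝ), 0 < ρ →
          (∀ q ∈ segment ℝ r₀ r, ∀ m ∈ Finset.Icc (-(M : ℤ)) (M : ℤ),
            ρ ≤ ‖q - elementPos ΔT m‖) →
          ∃ ε : ℝ,
            snr Pbar sigma2 M t ht ξ lam ΔT w r =
              snr Pbar sigma2 M t ht ξ lam ΔT w r₀ *
                (1 - (2 * ((r - r₀).ofLp ⬝ᵥ mVec M ΔT r₀)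
                  + (r - r₀).ofLp ⬝ᵥ (matM lam M ΔT r₀ *ᵥ (r - r₀).ofLp))) + ε ∧
            |ε| ≤ P.eval (1 / ρ) * ‖r - r₀‖ ^ 3) := by
  refine ⟨fun M ΔT r₀ _ hx hz => gammaOne_nonneg hx hz, fun absξ Pbar sigma2 lam hP hσ hlam => ?_⟩
  refine ⟨Polynomial.C (24 * (Pbar * (absξ / lam) ^ 2 / sigma2)) *
    fieldBound (2 * Real.pi / lam) ^ 2, ?_⟩
  rintro ξ rfl M hM t h1 ht ΔT hΔT r₀ hx hz u w hw r ρ hρ hseg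
  have hC : 0 ≤ Pbar * (‖ξ‖ / lam) ^ 2 / sigma2 := by positivity
  rw [Polynomial.eval_mul, Polynomial.eval_C, Polynomial.eval_pow]
  rcases eq_or_ne ξ 0 with rfl | hξ
  · exact ⟨0, by simp [snr_of_eq_zero], by rw [abs_zero]; positivity⟩
  have hD : ∀ m ∈ Finset.Icc (-(M : ℤ)) (M : ℤ), ∀ τ ∈ Set.Icc (0 : ℝ) 1,
      ρ ≤ rayDist (r₀ - elementPos ΔT m) (r - r₀) τ := fun m hm =>
    le_rayDist_of_segment fun q hq => hseg q hq m hm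
  have hD₀ : ∀ m ∈ Finset.Icc (-(M : ℤ)) (M : ℤ), ∀ τ ∈ Set.Icc (0 : ℝ) 1,
      ρ ≤ rayDist (r₀ - elementPos ΔT m) (r₀ - r₀) τ := fun m hm =>
    le_rayDist_of_segment fun q hq => hseg q
      (by rw [segment_same] at hq; exact hq ▸ left_mem_segment ℝ r₀ r) m hm
  have hs := arraySum_pos (M := M) (ΔT := ΔT) hz 2
  have hexp := abs_meanPower_sub_le hlam hρ hx hz hD
  -- For the zero displacement the expansion is exact, which gives the value at `r₀`.
  have h₀ : meanPower (2 * Real.pi / lam) M ΔT r₀ (r₀ - r₀) 1 = arraySum M ΔT r₀ 2 ^ 2 := by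
    have h := abs_meanPower_sub_le hlam hρ hx hz hD₀
    simpa [sub_eq_zero] using h
  rw [snr_eq_meanPower h1 hM hξ hlam hΔT hx hz hw, snr_eq_meanPower h1 hM hξ hlam hΔT hx hz hw, h₀]
  generalize meanPower (2 * Real.pi / lam) M ΔT r₀ (r - r₀) 1 = W at *
  generalize 2 * ((r - r₀).ofLp ⬝ᵥ mVec M ΔT r₀)
    + (r - r₀).ofLp ⬝ᵥ (matM lam M ΔT r₀ *ᵥ (r - r₀).ofLp) = Q at *
  generalize Pbar * (‖ξ‖ / lam) ^ 2 / sigma2 = C at *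
  refine ⟨C / arraySum M ΔT r₀ 2 * (W - arraySum M ΔT r₀ 2 ^ 2 * (1 - Q)), ?_, ?_⟩
  · field_simp
    ring
  · rw [abs_mul, abs_of_nonneg (by positivity)]
    refine (mul_le_mul_of_nonneg_left hexp (by positivity)).trans_eq ?_
    field_simp
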